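/- Definitions. All graphs are finite and simple. An orientable map with connected underlying graph $\Gamma$ (a 2-cell embedding of $\Gamma$ in a closed oriented surface) is given by its rotation, a permutation $R$ of the arcs (incident vertex-edge pairs) of $\Gamma$ whose cycles are the sets of arcs with a common initial vertex; isomorphisms of maps are the graph isomorphisms that commute with the rotations, and $\mathrm{Aut}^+(\mathcal M)$ is the group of automorphisms of $\mathcal M$ in this (orientation-preserving) sense. $\mathcal M$ is an orientably-regular embedding of $\Gamma$ if $\mathrm{Aut}^+(\mathcal M)$ acts regularly on the arcs. $K_{m[n]}$ is the complete multipartite graph with $m$ parts of size $n$. For a finite group $G=\langle a,b\rangle$ with $b^2=1$, $b\notin\langle a\rangle$ and $\langle a\rangle$ core-free, $\mathcal M(G;a,b)$ is the map whose vertices are the cosets $\langle a\rangle g$, whose arcs are the pairs $(\langle a\rangle g,\langle a\rangle bg)$, and whose rotation is $(\langle a\rangle g,\langle a\rangle bg)\mapsto(\langle a\rangle g,\langle a\rangle bag)$, for $g\in G$. Theorem. Let $p\ge 5$ be a prime, $e\ge 1$, and let $r$ be a given generator of $\mathbb Z_{p^{e+1}}^*$. Put $$G_1(p,e)=\langle a,c\mid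 a^{p^e(p-1)}=c^{p^{e+1}}=1,\ c^a=c^r\rangle,\qquad c^a=a^{-1}ca,$$ and, for $j\in\mathbb Z_{p^e(p-1)}^*$, $$\mathcal M_1(p,e,j)=\mathcal M\big(G_1(p,e);\,a^j,\,a^{\frac{p^e(p-1)}{2}}c\big).$$ 1. Let $\mathcal M$ be an orientably-regular embedding of $K_{p[p^e]}$ such that a Sylow $p$-subgroup $P$ of $\mathrm{Aut}^+(\mathcal M)$ has exponent $p^{e+1}$. Then $\mathrm{Aut}^+(\mathcal M)\cong G_1(p,e)$, and $\mathcal M$ is isomorphic to $\mathcal M_1(p,e,j)$ for some $j\in\mathbb Z_{p^e(p-1)}^*$. 2. For every $j\in\mathbb Z_{p^e(p-1)}^*$, $\mathcal M_1(p,e,j)$ is an orientably-regular embedding of $K_{p[p^e]}$. 3. If $j_1,j_2\in\mathbb Z_{p^e(p-1)}^*$ and $\mathcal M_1(p,e,j_1)\cong\mathcal M_1(p,e,j_2)$, then $j_1=j_2$. -/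

import Mathlib

/-- An orientable map (with a chosen orientation) whose underlying graph is the finite connected
simple graph `Γ`, given by its rotation: a permutation of the arcs of `Γ` whose cycles are exactly
the sets of arcs with a common initial vertex.  It describes a 2-cell embedding of `Γ` into a
closed oriented surface. -/
structure OrientedMap {V : Type*} (Γ : SimpleGraph V) where
  finite : Finite V
  connected : Γ.Connected
  rot : Equiv.Perm Γ.Dart
  rot_fst : ∀ d, (rot d).fst = d.fst
  rot_sameCycle : ∀ d d', d.fst = d'.fst → rot.SameCycle d d'

namespace OrientedMap

variable {V : Type*} {Γ : SimpleGraph V} {W : Type*} {Δ : SimpleGraph W}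

/-- The graph isomorphism `φ` is an orientation-preserving isomorphism of maps: it commutes with
the rotations. -/
def Preserves (M : OrientedMap Γ) (N : OrientedMap Δ) (φ : Γ ≃g Δ) : Prop :=
  ∀ d : Γ.Dart, φ.toHom.mapDart (M.rot d) = N.rot (φ.toHom.mapDart d)

/-- Isomorphism of oriented maps. -/
def Isomorphic (M : OrientedMap Γ) (N : OrientedMap Δ) : Prop :=
  ∃ φ : Γ ≃g Δ, Preserves M N φ

/-- The group of all orientation-preserving automorphisms of a map. -/
def autPlus (M : OrientedMap Γ) : Subgroup (Γ ≃g Γ) where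
  carrier := {φ | Preserves M M φ}
  one_mem' := fun _ => rfl
  mul_mem' := by
    intro φ ψ hφ hψ d
    have h : ∀ x, (φ * ψ : Γ ≃g Γ).toHom.mapDart x = φ.toHom.mapDart (ψ.toHom.mapDart x) :=
      fun _ => rfl
    rw [h, h, hψ d, hφ]
  inv_mem' := by
    intro φ hφ d
    have h : ∀ x, φ.toHom.mapDart ((φ⁻¹ : Γ ≃g Γ).toHom.mapDart x) = x := by
      intro x
      ext
      · exact φ.apply_symm_apply x.fst
      · exact φ.apply_symm_apply x.snd
    have hinj : Function.Injective φ.toHom.mapDart := by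
      intro x y hxy
      ext
      · exact φ.injective (congrArg (fun z => z.fst) hxy)
      · exact φ.injective (congrArg (fun z => z.snd) hxy)
    apply hinj
    rw [h, hφ, h]

/-- A map is orientably-regular if its group of orientation-preserving automorphisms acts
regularly on the arcs. -/
def IsOrientablyRegular (M : OrientedMap Γ) : Prop :=
  ∀ d d' : Γ.Dart, ∃! φ : M.autPlus, (φ : Γ ≃g Γ).toHom.mapDart d = d'

/-- `M` is an orientably-regular embedding of the graph `Δ`: it is orientably-regular and its
underlying graph is isomorphic to `Δ`. -/
def IsOrientablyRegularEmbeddingOf (M : OrientedMap Γ) (Δ : SimpleGraph W) : Prop :=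
  M.IsOrientablyRegular ∧ Nonempty (Γ ≃g Δ)

end OrientedMap

/-- The data of an algebraic map: a finite group `G` generated by `a` and `b`, where `b` is an
involution outside `⟨a⟩` and `⟨a⟩` is core-free. -/
structure AlgebraicTriple (G : Type*) [Group G] where
  a : G
  b : G
  finite : Finite G
  closure_eq_top : Subgroup.closure {a, b} = ⊤
  b_mul_self : b * b = 1
  b_notMem : b ∉ Subgroup.zpowers a
  coreFree : (Subgroup.zpowers a).normalCore = ⊥

namespace AlgebraicTriple

variable {G : Type*} [Group G] (T : AlgebraicTriple G)

/-- The set of right cosets `⟨a⟩g`. -/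
abbrev Vertex : Type _ := Quotient (QuotientGroup.rightRel (Subgroup.zpowers T.a))

/-- The right coset `⟨a⟩g`. -/
def coset (g : G) : T.Vertex := Quotient.mk _ g

lemma coset_eq {g h : G} : T.coset g = T.coset h ↔ h * g⁻¹ ∈ Subgroup.zpowers T.a := by
  rw [coset, coset, Quotient.eq, QuotientGroup.rightRel_apply]

lemma coset_surjective (v : T.Vertex) : ∃ g, v = T.coset g := by
  induction v using Quotient.inductionOn with
  | h g => exact ⟨g, rfl⟩

lemma coset_a_mul (g : G) : T.coset (T.a * g) = T.coset g := by
  rw [eq_comm, coset_eq]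
  simp

/-- The coset graph `Cos(G, ⟨a⟩, b)`: its arcs are the pairs `(⟨a⟩g, ⟨a⟩bg)`. -/
def cosetGraph : SimpleGraph T.Vertex where
  Adj u v := ∃ g, u = T.coset g ∧ v = T.coset (T.b * g)
  symm := by
    refine ⟨?_⟩
    rintro _ _ ⟨g, rfl, rfl⟩
    exact ⟨T.b * g, rfl, by rw [← mul_assoc, T.b_mul_self, one_mul]⟩
  loopless := by
    refine ⟨?_⟩
    rintro _ ⟨g, rfl, h⟩
    rw [coset_eq, mul_inv_cancel_right] at h
    exact T.b_notMem h

/-- The arc `(⟨a⟩g, ⟨a⟩bg)`. -/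
def arc (g : G) : T.cosetGraph.Dart := ⟨(T.coset g, T.coset (T.b * g)), g, rfl, rfl⟩

lemma arc_surjective (d : T.cosetGraph.Dart) : ∃ g, T.arc g = d := by
  obtain ⟨⟨u, v⟩, g, hu, hv⟩ := d
  obtain rfl : u = _ := hu
  obtain rfl : v = _ := hv
  exact ⟨g, rfl⟩

lemma arc_eq {g h : G} : T.arc g = T.arc h ↔
    T.coset g = T.coset h ∧ T.coset (T.b * g) = T.coset (T.b * h) := by
  rw [SimpleGraph.Dart.ext_iff, Prod.ext_iff]
  rfl

lemma arc_mul_eq {g h s : G} (hs : s ∈ Subgroup.zpowers T.a) (hgh : T.arc g = T.arc h) :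
    T.arc (s * g) = T.arc (s * h) := by
  rw [arc_eq, coset_eq, coset_eq] at hgh ⊢
  obtain ⟨h1, h2⟩ := hgh
  have hc : s * (h * g⁻¹) = (h * g⁻¹) * s := by
    obtain ⟨i, rfl⟩ := hs
    obtain ⟨k, hk⟩ := h1
    rw [← hk]
    exact (Commute.refl T.a).zpow_zpow i k
  have e1 : s * h * (s * g)⁻¹ = h * g⁻¹ := by
    calc s * h * (s * g)⁻¹ = s * (h * g⁻¹) * s⁻¹ := by group
      _ = _ := by rw [hc]; group
  have e2 : T.b * (s * h) * (T.b * (s * g))⁻¹ = T.b * h * (T.b * g)⁻¹ := by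
    calc _ = T.b * (s * h * (s * g)⁻¹) * T.b⁻¹ := by group
      _ = _ := by rw [e1]; group
  rw [e1, e2]
  exact ⟨h1, h2⟩

/-- The map on arcs `(⟨a⟩g, ⟨a⟩bg) ↦ (⟨a⟩sg, ⟨a⟩bsg)` for `s ∈ ⟨a⟩`. -/
noncomputable def shift (s : G) (d : T.cosetGraph.Dart) : T.cosetGraph.Dart :=
  T.arc (s * (T.arc_surjective d).choose)

lemma shift_arc {s : G} (hs : s ∈ Subgroup.zpowers T.a) (g : G) :
    T.shift s (T.arc g) = T.arc (s * g) :=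
  T.arc_mul_eq hs (T.arc_surjective (T.arc g)).choose_spec

lemma a_mem : T.a ∈ Subgroup.zpowers T.a := Subgroup.mem_zpowers T.a

/-- The rotation `(⟨a⟩g, ⟨a⟩bg) ↦ (⟨a⟩g, ⟨a⟩bag)`; recall `⟨a⟩ag = ⟨a⟩g`. -/
noncomputable def rotation : Equiv.Perm T.cosetGraph.Dart where
  toFun := T.shift T.a
  invFun := T.shift T.a⁻¹
  left_inv d := by
    obtain ⟨g, rfl⟩ := T.arc_surjective d
    rw [T.shift_arc T.a_mem, T.shift_arc (inv_mem T.a_mem), inv_mul_cancel_left]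
  right_inv d := by
    obtain ⟨g, rfl⟩ := T.arc_surjective d
    rw [T.shift_arc (inv_mem T.a_mem), T.shift_arc T.a_mem, mul_inv_cancel_left]

lemma rotation_arc (g : G) : T.rotation (T.arc g) = T.arc (T.a * g) := T.shift_arc T.a_mem g

lemma rotation_zpow_arc (i : ℤ) (g : G) : (T.rotation ^ i) (T.arc g) = T.arc (T.a ^ i * g) := by
  have hn : ∀ (n : ℕ) (g : G), (T.rotation ^ n) (T.arc g) = T.arc (T.a ^ n * g) := by
    intro n
    induction n with
    | zero => intro g; simp
    | succ n ih => intro g; rw [pow_succ, Equiv.Perm.mul_apply, rotation_arc, ih, pow_succ, mul_assoc]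
  obtain ⟨n, rfl | rfl⟩ := i.eq_nat_or_neg
  · simpa using hn n g
  · rw [zpow_neg, Equiv.Perm.inv_eq_iff_eq, zpow_natCast, hn]
    simp

lemma reachable_mul (x g : G) : T.cosetGraph.Reachable (T.coset g) (T.coset (x * g)) := by
  have hx : x ∈ Subgroup.closure {T.a, T.b} := by rw [T.closure_eq_top]; trivial
  induction hx using Subgroup.closure_induction generalizing g with
  | mem y hy =>
    rcases hy with rfl | rfl
    · rw [coset_a_mul]
    · exact SimpleGraph.Adj.reachable ⟨g, rfl, rfl⟩
  | one => rw [one_mul]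
  | mul y z _ _ hy hz =>
    rw [mul_assoc]
    exact (hz g).trans (hy _)
  | inv y _ hy =>
    have := hy (y⁻¹ * g)
    rw [mul_inv_cancel_left] at this
    exact this.symm

/-- The algebraic map `𝓜(G; a, b)`: the coset graph `Cos(G, ⟨a⟩, b)` with the rotation
`(⟨a⟩g, ⟨a⟩bg) ↦ (⟨a⟩g, ⟨a⟩bag)`. -/
noncomputable def toMap : OrientedMap T.cosetGraph where
  finite := by
    have := T.finite
    infer_instance
  connected := by
    have : Nonempty T.Vertex := ⟨T.coset 1⟩
    refine ⟨?_⟩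
    intro u v
    obtain ⟨g, rfl⟩ := T.coset_surjective u
    obtain ⟨h, rfl⟩ := T.coset_surjective v
    have := T.reachable_mul (h * g⁻¹) g
    rwa [inv_mul_cancel_right] at this
  rot := T.rotation
  rot_fst d := by
    obtain ⟨g, rfl⟩ := T.arc_surjective d
    rw [rotation_arc]
    exact T.coset_a_mul g
  rot_sameCycle d d' hd := by
    obtain ⟨g, rfl⟩ := T.arc_surjective d
    obtain ⟨h, rfl⟩ := T.arc_surjective d'
    obtain ⟨i, hi⟩ := T.coset_eq.1 hd
    refine ⟨i, ?_⟩
    have hi' : T.a ^ i = h * g⁻¹ := hi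
    rw [rotation_zpow_arc, hi', inv_mul_cancel_right]

end AlgebraicTriple

/-- The relators of `⟨a, c ∣ a^{p^e(p-1)} = c^{p^{e+1}} = 1, c^a = c^r⟩`, where `a`, `c` are the
free generators `0`, `1` and `c^a = a⁻¹ca`. -/
def G1Rels (p e : ℕ) (r : (ZMod (p ^ (e + 1)))ˣ) : Set (FreeGroup (Fin 2)) :=
  {FreeGroup.of 0 ^ (p ^ e * (p - 1)),
   FreeGroup.of 1 ^ (p ^ (e + 1)),
   (FreeGroup.of 0)⁻¹ * FreeGroup.of 1 * FreeGroup.of 0 *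
    (FreeGroup.of 1 ^ (r : ZMod (p ^ (e + 1))).val)⁻¹}

/-- The group `G₁(p, e) = ⟨a, c ∣ a^{p^e(p-1)} = c^{p^{e+1}} = 1, c^a = c^r⟩`. -/
abbrev G1 (p e : ℕ) (r : (ZMod (p ^ (e + 1)))ˣ) : Type := PresentedGroup (G1Rels p e r)

namespace G1

variable (p e : ℕ) (r : (ZMod (p ^ (e + 1)))ˣ)

/-- The generator `a` of `G₁(p, e)`. -/
def a : G1 p e r := PresentedGroup.of 0

/-- The generator `c` of `G₁(p, e)`. -/
def c : G1 p e r := PresentedGroup.of 1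

/-- The element `b = a^{p^e(p-1)/2} c` of `G₁(p, e)`. -/
def b : G1 p e r := a p e r ^ (p ^ e * (p - 1) / 2) * c p e r

lemma a_pow : a p e r ^ (p ^ e * (p - 1)) = 1 :=
  PresentedGroup.one_of_mem (rels := G1Rels p e r) (Or.inl rfl)

lemma c_pow : c p e r ^ (p ^ (e + 1)) = 1 :=
  PresentedGroup.one_of_mem (rels := G1Rels p e r) (Or.inr (Or.inl rfl))

lemma conj_c : (a p e r)⁻¹ * c p e r * a p e r = c p e r ^ (r : ZMod (p ^ (e + 1))).val :=
  mul_inv_eq_one.1 (PresentedGroup.one_of_mem (rels := G1Rels p e r) (Or.inr (Or.inr rfl)))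

lemma closure_eq_top : Subgroup.closure {a p e r, c p e r} = ⊤ := by
  rw [eq_top_iff, ← PresentedGroup.closure_range_of (G1Rels p e r)]
  apply Subgroup.closure_mono
  rintro _ ⟨i, rfl⟩
  fin_cases i
  · exact Or.inl rfl
  · exact Or.inr rfl

variable {p e r}

lemma c_pow_congr {m n : ℕ} (h : (m : ZMod (p ^ (e + 1))) = n) : c p e r ^ m = c p e r ^ n :=
  pow_eq_pow_of_modEq ((ZMod.natCast_eq_natCast_iff _ _ _).1 h) (c_pow p e r)

variable [hp : Fact p.Prime]

lemma conj_c_pow (k : ℕ) : (a p e r ^ k)⁻¹ * c p e r * a p e r ^ k =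
    c p e r ^ ((r ^ k : (ZMod (p ^ (e + 1)))ˣ) : ZMod (p ^ (e + 1))).val := by
  induction k with
  | zero =>
    rw [pow_zero, pow_zero, inv_one, one_mul, mul_one]
    conv_lhs => rw [← pow_one (c p e r)]
    apply c_pow_congr
    simp
  | succ k ih =>
    have h : (a p e r ^ (k + 1))⁻¹ * c p e r * a p e r ^ (k + 1) =
        (a p e r)⁻¹ * ((a p e r ^ k)⁻¹ * c p e r * a p e r ^ k) * a p e r := by
      rw [pow_succ]; group
    have h2 : ∀ m : ℕ, (a p e r)⁻¹ * (c p e r ^ m) * a p e r =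
        ((a p e r)⁻¹ * c p e r * a p e r) ^ m := by
      intro m
      have := (conj_pow (i := m) (a := (a p e r)⁻¹) (b := c p e r)).symm
      simpa using this
    rw [h, ih, h2, conj_c, ← pow_mul]
    apply c_pow_congr
    simp [pow_succ, mul_comm]

lemma card_units : Fintype.card (ZMod (p ^ (e + 1)))ˣ = p ^ e * (p - 1) := by
  rw [ZMod.card_units_eq_totient, Nat.totient_prime_pow_succ hp.out]

/-- The action of `G₁(p, e)` on `ℤ/p^{e+1}` in which `a` is multiplication by `r⁻¹` and `c` is
translation by `1`. -/
def affine : G1 p e r →* Equiv.Perm (ZMod (p ^ (e + 1))) :=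
  PresentedGroup.toGroup (rels := G1Rels p e r)
    (f := ![MulAction.toPermHom _ _ r⁻¹, Equiv.addLeft 1]) (by
    rintro _ (rfl | rfl | rfl)
    · simp only [map_pow, FreeGroup.lift_apply_of, Matrix.cons_val_zero]
      rw [← map_pow, ← card_units, pow_card_eq_one, map_one]
    · simp only [map_pow, FreeGroup.lift_apply_of, Matrix.cons_val_one,
        Matrix.cons_val_fin_one]
      ext x
      rw [Equiv.nsmul_addLeft]
      simp
    · simp only [map_mul, map_inv, map_pow, FreeGroup.lift_apply_of, Matrix.cons_val_zero,
        Matrix.cons_val_one, Matrix.cons_val_fin_one]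
      rw [mul_inv_eq_one, Equiv.nsmul_addLeft]
      ext x
      simp [Equiv.Perm.mul_apply, Units.smul_def, add_comm])

lemma affine_a_pow (k : ℕ) (x : ZMod (p ^ (e + 1))) :
    affine (a p e r ^ k) x = ((r⁻¹ ^ k : (ZMod (p ^ (e + 1)))ˣ) : ZMod (p ^ (e + 1))) * x := by
  rw [map_pow, a, affine, PresentedGroup.toGroup.of, Matrix.cons_val_zero, ← map_pow]
  rfl

lemma affine_c (x : ZMod (p ^ (e + 1))) : affine (c p e r) x = 1 + x := by
  rw [c, affine, PresentedGroup.toGroup.of]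
  rfl

instance : Nontrivial (ZMod (p ^ (e + 1))) :=
  ZMod.nontrivial_iff.2 (Nat.one_lt_pow (Nat.succ_ne_zero e) hp.out.one_lt).ne'

lemma exists_pow_of_mem {g : G1 p e r} (hg : g ∈ Subgroup.zpowers (a p e r)) :
    ∃ k : ℕ, a p e r ^ k = g := by
  have h : IsOfFinOrder (a p e r) := isOfFinOrder_iff_pow_eq_one.2
    ⟨_, Nat.mul_pos (pow_pos hp.out.pos e) (Nat.sub_pos_of_lt hp.out.one_lt), a_pow p e r⟩
  obtain ⟨k, hk⟩ := h.mem_powers_iff_mem_zpowers.2 hg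
  exact ⟨k, hk⟩

lemma b_notMem : b p e r ∉ Subgroup.zpowers (a p e r) := by
  intro h
  obtain ⟨k, hk⟩ := exists_pow_of_mem h
  have h0 := congrArg (fun g => affine g 0) hk
  simp only [affine_a_pow, b, map_mul, Equiv.Perm.mul_apply, affine_c, mul_zero, add_zero,
    mul_one] at h0
  exact (Units.ne_zero _) h0.symm

lemma exists_eq_mul (g : G1 p e r) :
    ∃ x ∈ Subgroup.zpowers (a p e r), ∃ y ∈ Subgroup.zpowers (c p e r), g = x * y := by
  have hpos : 0 < p ^ e * (p - 1) :=
    Nat.mul_pos (pow_pos hp.out.pos e) (Nat.sub_pos_of_lt hp.out.one_lt)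
  have hc : ∀ k : ℕ, (a p e r ^ k)⁻¹ * c p e r * a p e r ^ k ∈ Subgroup.zpowers (c p e r) := by
    intro k
    rw [conj_c_pow]
    exact pow_mem (Subgroup.mem_zpowers _) _
  have hcz : ∀ x ∈ Subgroup.zpowers (a p e r), ∀ y ∈ Subgroup.zpowers (c p e r),
      x⁻¹ * y * x ∈ Subgroup.zpowers (c p e r) := by
    intro x hx y hy
    obtain ⟨k, rfl⟩ := exists_pow_of_mem hx
    obtain ⟨i, rfl⟩ := hy
    have h := zpow_mem (hc k) i
    have e1 := conj_zpow (i := i) (a := (a p e r ^ k)⁻¹) (b := c p e r)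
    rw [inv_inv] at e1
    rwa [e1] at h
  have hg : g ∈ Subgroup.closure {a p e r, c p e r} := by rw [closure_eq_top]; trivial
  have ha := Subgroup.mem_zpowers (a p e r)
  have hcc := Subgroup.mem_zpowers (c p e r)
  induction hg using Subgroup.closure_induction with
  | mem y hy =>
    rcases hy with rfl | rfl
    · exact ⟨_, ha, 1, one_mem _, by simp⟩
    · exact ⟨1, one_mem _, _, hcc, by simp⟩
  | one => exact ⟨1, one_mem _, 1, one_mem _, by simp⟩
  | mul g h _ _ hg hh =>
    obtain ⟨x, hx, y, hy, rfl⟩ := hg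
    obtain ⟨z, hz, w, hw, rfl⟩ := hh
    exact ⟨x * z, mul_mem hx hz, (z⁻¹ * y * z) * w, mul_mem (hcz z hz y hy) hw, by group⟩
  | inv g _ hg =>
    obtain ⟨x, hx, y, hy, rfl⟩ := hg
    refine ⟨x⁻¹, inv_mem hx, _, hcz x⁻¹ (inv_mem hx) y⁻¹ (inv_mem hy), by group⟩

instance finite : Finite (G1 p e r) := by
  have h1 : IsOfFinOrder (a p e r) := isOfFinOrder_iff_pow_eq_one.2
    ⟨_, Nat.mul_pos (pow_pos hp.out.pos e) (Nat.sub_pos_of_lt hp.out.one_lt), a_pow p e r⟩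
  have h2 : IsOfFinOrder (c p e r) := isOfFinOrder_iff_pow_eq_one.2
    ⟨_, pow_pos hp.out.pos _, c_pow p e r⟩
  have f1 : Finite (Subgroup.zpowers (a p e r)) := (finite_zpowers.2 h1).to_subtype
  have f2 : Finite (Subgroup.zpowers (c p e r)) := (finite_zpowers.2 h2).to_subtype
  refine Finite.of_surjective
    (fun q : Subgroup.zpowers (a p e r) × Subgroup.zpowers (c p e r) => (q.1 * q.2 : G1 p e r)) ?_
  intro g
  obtain ⟨x, hx, y, hy, rfl⟩ := exists_eq_mul g
  exact ⟨(⟨x, hx⟩, ⟨y, hy⟩), rfl⟩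

lemma eq_one_of_mem_normalCore (hr : ∀ u, u ∈ Subgroup.zpowers r) {g : G1 p e r}
    (hg : g ∈ (Subgroup.zpowers (a p e r)).normalCore) : g = 1 := by
  obtain ⟨k, rfl⟩ := exists_pow_of_mem (Subgroup.normalCore_le _ hg)
  obtain ⟨l, hl⟩ := exists_pow_of_mem (hg (c p e r)⁻¹)
  have h : a p e r ^ k * c p e r = c p e r * a p e r ^ l := by rw [hl]; group
  have h0 := congrArg (fun g => affine g 0) h
  simp only [affine_a_pow, map_mul, Equiv.Perm.mul_apply, affine_c, mul_zero, add_zero,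
    mul_one] at h0
  rw [Units.val_eq_one, inv_pow, inv_eq_one] at h0
  have h1 := orderOf_dvd_of_pow_eq_one h0
  rw [orderOf_eq_card_of_forall_mem_zpowers hr, Nat.card_eq_fintype_card, card_units] at h1
  obtain ⟨m, rfl⟩ := h1
  rw [pow_mul, a_pow, one_pow]

lemma two_dvd (h5 : 5 ≤ p) : 2 ∣ p ^ e * (p - 1) := by
  have := hp.out.eq_two_or_odd
  exact Dvd.dvd.mul_left (by omega) _

lemma pow_half (h5 : 5 ≤ p) (hr : ∀ u, u ∈ Subgroup.zpowers r) :
    r ^ (p ^ e * (p - 1) / 2) = -1 := by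
  have hcyc : IsCyclic (ZMod (p ^ (e + 1)))ˣ := ⟨r, hr⟩
  have hpos : 0 < p ^ e * (p - 1) :=
    Nat.mul_pos (pow_pos hp.out.pos e) (Nat.sub_pos_of_lt hp.out.one_lt)
  have hN : p ^ e * (p - 1) / 2 * 2 = p ^ e * (p - 1) := Nat.div_mul_cancel (two_dvd h5)
  set x := r ^ (p ^ e * (p - 1) / 2) with hx
  have hx2 : x ^ 2 = 1 := by rw [hx, ← pow_mul, hN, ← card_units, pow_card_eq_one]
  have hx1 : x ≠ 1 := by
    intro h
    have h1 := orderOf_dvd_of_pow_eq_one h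
    rw [orderOf_eq_card_of_forall_mem_zpowers hr, Nat.card_eq_fintype_card, card_units] at h1
    have := Nat.le_of_dvd (by omega) h1
    omega
  have hm1 : (-1 : (ZMod (p ^ (e + 1)))ˣ) ≠ 1 := by
    intro h
    have h2 : ((2 : ℕ) : ZMod (p ^ (e + 1))) = 0 := by
      have := congrArg (Units.val) h
      rw [Units.val_neg, Units.val_one] at this
      push_cast
      linear_combination -this
    rw [ZMod.natCast_eq_zero_iff] at h2
    have h3 := Nat.le_of_dvd two_pos h2
    have h4 := Nat.le_self_pow (Nat.succ_ne_zero e) p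
    simp only [Nat.succ_eq_add_one] at h4
    omega
  by_contra hne
  have hcard := IsCyclic.card_pow_eq_one_le (α := (ZMod (p ^ (e + 1)))ˣ) (n := 2) two_pos
  have hsub : ({1, -1, x} : Finset (ZMod (p ^ (e + 1)))ˣ) ⊆
      Finset.univ.filter fun y => y ^ 2 = 1 := by
    intro y hy
    simp only [Finset.mem_insert, Finset.mem_singleton] at hy
    rcases hy with rfl | rfl | rfl <;> simp [hx2]
  have h3 : ({1, -1, x} : Finset (ZMod (p ^ (e + 1)))ˣ).card = 3 := by
    rw [Finset.card_eq_three]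
    exact ⟨_, _, _, hm1.symm, hx1.symm, Ne.symm hne, rfl⟩
  have := (Finset.card_le_card hsub).trans hcard
  omega

lemma b_mul_self (h5 : 5 ≤ p) (hr : ∀ u, u ∈ Subgroup.zpowers r) : b p e r * b p e r = 1 := by
  have h := conj_c_pow (r := r) (p ^ e * (p - 1) / 2)
  have h2 : a p e r ^ (p ^ e * (p - 1) / 2) * a p e r ^ (p ^ e * (p - 1) / 2) = 1 := by
    rw [← pow_two, ← pow_mul, Nat.div_mul_cancel (two_dvd h5), a_pow]
  rw [← eq_inv_iff_mul_eq_one] at h2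
  rw [pow_half h5 hr, ← h2] at h
  have h4 : c p e r ^ ((-1 : (ZMod (p ^ (e + 1)))ˣ) : ZMod (p ^ (e + 1))).val * c p e r = 1 := by
    rw [← pow_succ, ← pow_zero (c p e r)]
    apply c_pow_congr
    simp
  rw [b, ← mul_assoc, h, h4]

lemma zpowers_a_pow (j : (ZMod (p ^ e * (p - 1)))ˣ) :
    Subgroup.zpowers (a p e r ^ (j : ZMod (p ^ e * (p - 1))).val) =
      Subgroup.zpowers (a p e r) := by
  apply le_antisymm
  · rw [Subgroup.zpowers_le]
    exact pow_mem (Subgroup.mem_zpowers _) _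
  · rw [Subgroup.zpowers_le]
    have : NeZero (p ^ e * (p - 1)) :=
      ⟨(Nat.mul_pos (pow_pos hp.out.pos e) (Nat.sub_pos_of_lt hp.out.one_lt)).ne'⟩
    have h : (a p e r ^ (j : ZMod (p ^ e * (p - 1))).val) ^
        ((j⁻¹ : (ZMod (p ^ e * (p - 1)))ˣ) : ZMod (p ^ e * (p - 1))).val = a p e r := by
      rw [← pow_mul]
      conv_rhs => rw [← pow_one (a p e r)]
      refine pow_eq_pow_of_modEq ((ZMod.natCast_eq_natCast_iff _ _ _).1 ?_) (a_pow p e r)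
      simp
    have h' := pow_mem (Subgroup.mem_zpowers (a p e r ^ (j : ZMod (p ^ e * (p - 1))).val))
      ((j⁻¹ : (ZMod (p ^ e * (p - 1)))ˣ) : ZMod (p ^ e * (p - 1))).val
    rwa [h] at h'

/-- The generating pair `(a^j, b)` of `G₁(p, e)`, where `r` generates `(ℤ/p^{e+1})ˣ` and `j` is a
unit modulo `p^e(p-1)`. -/
def triple (h5 : 5 ≤ p) (hr : ∀ u, u ∈ Subgroup.zpowers r) (j : (ZMod (p ^ e * (p - 1)))ˣ) :
    AlgebraicTriple (G1 p e r) where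
  a := a p e r ^ (j : ZMod (p ^ e * (p - 1))).val
  b := b p e r
  finite := G1.finite
  closure_eq_top := by
    set S := Subgroup.closure {a p e r ^ (j : ZMod (p ^ e * (p - 1))).val, b p e r} with hS
    have h1 : Subgroup.zpowers (a p e r) ≤ S := by
      rw [← zpowers_a_pow j, Subgroup.zpowers_le]
      exact Subgroup.subset_closure (Or.inl rfl)
    have h2 : b p e r ∈ S := Subgroup.subset_closure (Or.inr rfl)
    have ha : a p e r ∈ S := h1 (Subgroup.mem_zpowers _)
    rw [eq_top_iff, ← closure_eq_top p e r, Subgroup.closure_le]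
    rintro x (rfl | rfl)
    · exact ha
    · rw [b] at h2
      exact (S.mul_mem_cancel_left (S.pow_mem ha _)).1 h2
  b_mul_self := b_mul_self h5 hr
  b_notMem := by
    rw [zpowers_a_pow]
    exact b_notMem
  coreFree := by
    rw [zpowers_a_pow, eq_bot_iff]
    intro g hg
    exact eq_one_of_mem_normalCore hr hg

end G1

/-- The map `𝓜₁(p, e, j) = 𝓜(G₁(p, e); a^j, a^{p^e(p-1)/2} c)`, formed with the generator `r` of
`(ℤ/p^{e+1})ˣ`. -/
noncomputable def M1 (p e : ℕ) [Fact p.Prime] (h5 : 5 ≤ p) (r : (ZMod (p ^ (e + 1)))ˣ)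
    (hr : ∀ u, u ∈ Subgroup.zpowers r) (j : (ZMod (p ^ e * (p - 1)))ˣ) :
    OrientedMap (G1.triple h5 hr j).cosetGraph :=
  (G1.triple h5 hr j).toMap

/-! Let `G` be the automorphism group of such a map. Regularity on arcs gives `|G| = p^(2e+1)(p-1)`,
a cyclic vertex stabilizer `⟨a⟩` of order `p^e(p-1)`, and an involution `b` reversing an arc. The
stabilizer `H` of a part has index `p`. For `g ∉ H` the base vertex and its image under `g` are
adjacent, so `⟨a⟩` meets `⟨a⟩^g` trivially. Everything in the classification follows from this
configuration.

The Sylow `p`-subgroup `P` is normal and `K = P ∩ H` has index `p` in it. With `z = a^(p-1)` and `g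
∈ P \ K`, `K` is the product of `⟨z⟩` and a conjugate of it, two cyclic groups of order `p^e`
meeting trivially. For odd `p` such a product has exponent `p^e` (`CyclicFactorization.pow_eq_one`):
its elements `a^i b^j` with both factors of order dividing `p` form a normal subgroup of exponent
`p` (`CyclicFactorization.socle_conj`), and one passes to the quotient. Hence, when `P` has exponent
`p^(e+1)`, an element `c` of that order lies outside `K`, and `P = ⟨c⟩⟨z⟩` with trivial
intersection.

The core is `CyclicFactorization.exists_normal_factor`: `c` can be replaced by `d` with `⟨d⟩` normal
in `P` and invariant under the `p'`-part `a^(p^e)` of `a`. This operator fixes `z`, and on `P/K` it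
is a power map with exponent `k ≢ 1` modulo `p`, since otherwise `H` would contain too many
products. The two distinct eigenvalues allow `d` to be separated from powers of `z` at each step of
an induction over socle quotients.

Thus `G` is the semidirect product of a cyclic group of order `p^(e+1)` by `⟨a⟩`. The action is
faithful because powers of `a` commuting with `b` are trivial, so `a` acts as a generator of the
unit group; the given `r` is a power of that generator, which yields `G₁(p, e)` and the parameter
`j`.

Conversely, `G₁(p, e)` acts on `ℤ/p^(e+1)` by affine maps with `⟨a⟩` the stabilizer of `0`;
adjacency becomes "the difference is a unit", that is, different residues modulo `p`. Finally, `j`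
is an invariant because the relation `c^(a^j) = c^(r^j)` can be written as a word in the rotation
and the arc reversal. -/

/-! ### Factorizations into two cyclic `p`-groups -/

/-- The group `P` is the product of the cyclic subgroups generated by `a`, of order `p ^ α`, and by
`b`, of order `p ^ β`, which meet trivially. -/
structure CyclicFactorization {P : Type*} [Group P] (p : ℕ) (a b : P) (α β : ℕ) : Prop where
  exists_eq : ∀ g : P, ∃ i j : ℤ, g = a ^ i * b ^ j
  eq_one_iff : ∀ i j : ℤ, a ^ i * b ^ j = 1 ↔ (p : ℤ) ^ α ∣ i ∧ (p : ℤ) ^ β ∣ j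

/-- The subgroup generated by two commuting elements. -/
def Commute.span {P : Type*} [Group P] {x y : P} (h : Commute x y) : Subgroup P where
  carrier := {g | ∃ i j : ℤ, g = x ^ i * y ^ j}
  one_mem' := ⟨0, 0, by simp⟩
  mul_mem' := by
    rintro _ _ ⟨i, j, rfl⟩ ⟨k, l, rfl⟩
    refine ⟨i + k, j + l, ?_⟩
    rw [zpow_add, zpow_add, mul_assoc, ← mul_assoc (y ^ j), ← (h.zpow_zpow k j).eq]
    group
  inv_mem' := by
    rintro _ ⟨i, j, rfl⟩
    refine ⟨-i, -j, ?_⟩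
    rw [mul_inv_rev, ← zpow_neg, ← zpow_neg, (h.zpow_zpow _ _).eq]

/-- If `y x = x y t` with `t` commuting with `x` and `y`, then `(xy)^n = x^n y^n t^(n choose 2)`. -/
lemma mul_pow_of_central {P : Type*} [Group P] {x y t : P} (h : y * x = x * y * t)
    (hx : Commute t x) (hy : Commute t y) (n : ℕ) :
    (x * y) ^ n = x ^ n * y ^ n * t ^ (n.choose 2) := by
  have hyx : ∀ n : ℕ, y ^ n * x = x * y ^ n * t ^ n := by
    intro n
    induction n with
    | zero => simp
    | succ n ih =>
      calc y ^ (n + 1) * x = y ^ n * (y * x) := by rw [pow_succ, mul_assoc]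
        _ = (y ^ n * x) * (y * t) := by rw [h]; simp only [mul_assoc]
        _ = x * y ^ n * (t ^ n * y) * t := by rw [ih]; simp only [mul_assoc]
        _ = _ := by rw [(hy.pow_left n).eq, pow_succ, pow_succ]; simp only [mul_assoc]
  induction n with
  | zero => simp
  | succ n ih =>
    have h1 : Commute (t ^ n.choose 2) (x * y) := (hx.mul_right hy).pow_left _
    calc (x * y) ^ (n + 1) = x ^ n * y ^ n * (t ^ n.choose 2 * (x * y)) := by
          rw [pow_succ, ih, mul_assoc]
      _ = x ^ n * (y ^ n * x) * y * t ^ n.choose 2 := by rw [h1.eq]; simp only [mul_assoc]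
      _ = x ^ (n + 1) * y ^ n * (t ^ n * y) * t ^ n.choose 2 := by
          rw [hyx, pow_succ]; simp only [mul_assoc]
      _ = _ := by
          rw [(hy.pow_left n).eq, pow_succ y, Nat.choose_succ_succ' n 1, Nat.choose_one_right,
            pow_add t]
          simp only [mul_assoc]

/-- For odd `p` the binomial coefficient `p.choose 2` is divisible by `p`, so the commutator term
disappears. This is the only way in which oddness of `p` enters the power computations. -/
lemma mul_pow_prime_of_central {P : Type*} [Group P] {p : ℕ} [hp : Fact p.Prime] (h2 : p ≠ 2)
    {x y t : P} (h : y * x = x * y * t) (hx : Commute t x) (hy : Commute t y) (ht : t ^ p = 1) :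
    (x * y) ^ p = x ^ p * y ^ p := by
  have h3 := hp.out.two_le
  obtain ⟨m, hm⟩ := hp.out.dvd_choose_self two_ne_zero (by omega)
  rw [mul_pow_of_central h hx hy, hm, pow_mul, ht, one_pow, mul_one]

namespace CyclicFactorization

variable {P : Type*} [Group P] {p : ℕ} {a b : P} {α β : ℕ}

lemma symm (h : CyclicFactorization p a b α β) : CyclicFactorization p b a β α where
  exists_eq g := by
    obtain ⟨i, j, hg⟩ := h.exists_eq g⁻¹
    exact ⟨-j, -i, by rw [← inv_inv g, hg]; group⟩
  eq_one_iff i j := by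
    rw [and_comm, ← dvd_neg, ← dvd_neg (b := i), ← h.eq_one_iff, ← inv_eq_one]
    simp

lemma eq_iff (h : CyclicFactorization p a b α β) (i j k l : ℤ) :
    a ^ i * b ^ j = a ^ k * b ^ l ↔ (p : ℤ) ^ α ∣ i - k ∧ (p : ℤ) ^ β ∣ j - l := by
  have e : a ^ (i - k) * b ^ (j - l) = (a ^ k)⁻¹ * (a ^ i * b ^ j * (a ^ k * b ^ l)⁻¹) * a ^ k := by
    rw [sub_eq_neg_add, zpow_add]
    group
  rw [← h.eq_one_iff, e, ← mul_inv_eq_one]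
  constructor
  · intro e1
    rw [e1]
    group
  · intro e1
    simpa using (conj_eq_one_iff (a := (a ^ k)⁻¹)).1 (by simpa using e1)

lemma zpow_left_eq_one_iff (h : CyclicFactorization p a b α β) (i : ℤ) :
    a ^ i = 1 ↔ (p : ℤ) ^ α ∣ i := by
  simpa using h.eq_one_iff i 0

lemma zpow_right_eq_one_iff (h : CyclicFactorization p a b α β) (j : ℤ) :
    b ^ j = 1 ↔ (p : ℤ) ^ β ∣ j := by
  simpa using h.eq_one_iff 0 j

lemma orderOf_left (h : CyclicFactorization p a b α β) : orderOf a = p ^ α := by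
  apply Nat.dvd_antisymm
  · rw [orderOf_dvd_iff_pow_eq_one, ← zpow_natCast, h.zpow_left_eq_one_iff]
    simp
  · have := (h.zpow_left_eq_one_iff (orderOf a)).1 (by rw [zpow_natCast, pow_orderOf_eq_one])
    exact_mod_cast this

lemma orderOf_right (h : CyclicFactorization p a b α β) : orderOf b = p ^ β :=
  h.symm.orderOf_left

lemma isComplement' (h : CyclicFactorization p a b α β) :
    Subgroup.IsComplement' (Subgroup.zpowers a) (Subgroup.zpowers b) := by
  apply Subgroup.isComplement'_of_disjoint_and_mul_eq_univ
  · rw [Subgroup.disjoint_def]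
    rintro _ ⟨i, rfl⟩ ⟨j, hj⟩
    simp only at hj ⊢
    rw [h.zpow_left_eq_one_iff]
    refine ((h.eq_one_iff i (-j)).1 ?_).1
    rw [zpow_neg, hj, mul_inv_cancel]
  · rw [Set.eq_univ_iff_forall]
    intro g
    obtain ⟨i, j, rfl⟩ := h.exists_eq g
    exact Set.mul_mem_mul ⟨i, rfl⟩ ⟨j, rfl⟩

lemma card (h : CyclicFactorization p a b α β) : Nat.card P = p ^ (α + β) := by
  rw [← h.isComplement'.card_mul_card, Nat.card_zpowers, Nat.card_zpowers, h.orderOf_left,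
    h.orderOf_right, pow_add]

lemma of_card [hp : Fact p.Prime] (ha : orderOf a = p ^ α) (hb : orderOf b = p ^ β)
    (hc : Nat.card P = p ^ (α + β))
    (hd : ∀ i j : ℤ, a ^ i = b ^ j → a ^ i = 1) : CyclicFactorization p a b α β := by
  have : Finite P := Nat.finite_of_card_ne_zero (by rw [hc]; exact pow_ne_zero _ hp.out.ne_zero)
  have hcomp : Subgroup.IsComplement' (Subgroup.zpowers a) (Subgroup.zpowers b) := by
    apply Subgroup.isComplement'_of_card_mul_and_disjoint
    · rw [Nat.card_zpowers, Nat.card_zpowers, ha, hb, hc, pow_add]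
    · rw [Subgroup.disjoint_def]
      rintro _ ⟨i, rfl⟩ ⟨j, hj⟩
      exact hd i j hj.symm
  refine ⟨fun g => ?_, fun i j => ?_⟩
  · obtain ⟨⟨⟨_, i, rfl⟩, ⟨_, j, rfl⟩⟩, hg⟩ := hcomp.2 g
    exact ⟨i, j, hg.symm⟩
  · have h1 : a ^ i = 1 ↔ (p : ℤ) ^ α ∣ i := by
      rw [← orderOf_dvd_iff_zpow_eq_one, ha]; push_cast; rfl
    have h2 : b ^ j = 1 ↔ (p : ℤ) ^ β ∣ j := by
      rw [← orderOf_dvd_iff_zpow_eq_one, hb]; push_cast; rfl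
    rw [← h1, ← h2]
    constructor
    · intro e
      have e1 := hd i (-j) (by rw [zpow_neg, ← mul_eq_one_iff_eq_inv, e])
      rw [e1, one_mul] at e
      exact ⟨e1, e⟩
    · rintro ⟨e1, e2⟩
      rw [e1, e2, one_mul]

lemma quotient (h : CyclicFactorization p a b α β) (N : Subgroup P) [N.Normal] {α' β' : ℕ}
    (hN : ∀ i j : ℤ, a ^ i * b ^ j ∈ N ↔ (p : ℤ) ^ α' ∣ i ∧ (p : ℤ) ^ β' ∣ j) :
    CyclicFactorization p (a : P ⧸ N) (b : P ⧸ N) α' β' where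
  exists_eq g := by
    obtain ⟨g, rfl⟩ := QuotientGroup.mk_surjective g
    obtain ⟨i, j, rfl⟩ := h.exists_eq g
    exact ⟨i, j, rfl⟩
  eq_one_iff i j := by
    rw [← hN, ← QuotientGroup.eq_one_iff]
    rfl

lemma commute_of_commute (h : CyclicFactorization p a b α β) {x : P} (ha : Commute x a)
    (hb : Commute x b) (g : P) : Commute x g := by
  obtain ⟨i, j, rfl⟩ := h.exists_eq g
  exact (ha.zpow_right i).mul_right (hb.zpow_right j)

/-- Multiplying the central element by `b ^ (-j)` leaves `a ^ i`, which therefore commutes with `b`,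
and trivially with `a`; likewise for `b ^ j`. -/
lemma central_factors (h : CyclicFactorization p a b α β) {i j : ℤ}
    (hx : ∀ g, Commute (a ^ i * b ^ j) g) :
    (∀ g, Commute (a ^ i) g) ∧ ∀ g, Commute (b ^ j) g := by
  have h1 : Commute (a ^ i) b := by
    have := (hx b).mul_left ((Commute.refl b).zpow_left (-j))
    simpa using this
  have h2 : Commute (b ^ j) a := by
    have := ((Commute.refl a).zpow_left (-i)).mul_left (hx a)
    simpa using this
  exact ⟨h.commute_of_commute ((Commute.refl a).zpow_left i) h1,
    h.commute_of_commute h2 ((Commute.refl b).zpow_left j)⟩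

/-- A nontrivial power of `a` of order `p` has the same centralizer as `a ^ p ^ α`. -/
lemma commute_socle_of_commute [hp : Fact p.Prime] (h : CyclicFactorization p a b (α + 1) β)
    {i : ℤ} (hi : (p : ℤ) ^ (α + 1) ∣ i * p) (h1 : a ^ i ≠ 1) {g : P} (hg : Commute (a ^ i) g) :
    Commute (a ^ (p ^ α)) g := by
  have hp0 : (p : ℤ) ≠ 0 := by exact_mod_cast hp.out.ne_zero
  rw [pow_succ, mul_dvd_mul_iff_right hp0] at hi
  obtain ⟨u, rfl⟩ := hi
  rw [Ne, h.zpow_left_eq_one_iff, pow_succ, mul_dvd_mul_iff_left (pow_ne_zero _ hp0)] at h1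
  have hco : IsCoprime (p : ℤ) u :=
    (Int.prime_iff_natAbs_prime.2 (by simpa using hp.out)).coprime_iff_not_dvd.2 h1
  obtain ⟨s, t, hst⟩ := hco
  have h2 : a ^ (p ^ α) = (a ^ ((p : ℤ) ^ α * u)) ^ t := by
    rw [← zpow_natCast, ← zpow_mul]
    apply eq_of_mul_inv_eq_one
    rw [← zpow_sub, h.zpow_left_eq_one_iff]
    refine ⟨s, ?_⟩
    push_cast
    linear_combination (-(p : ℤ) ^ α) * hst
  rw [h2]
  exact hg.zpow_left t

lemma central_dvd (h : CyclicFactorization p a b α β)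
    {i j : ℤ} (hx : ∀ g, Commute (a ^ i * b ^ j) g) (hxp : (a ^ i * b ^ j) ^ p = 1) :
    (p : ℤ) ^ α ∣ i * p ∧ (p : ℤ) ^ β ∣ j * p := by
  obtain ⟨h1, h2⟩ := h.central_factors hx
  rw [(h1 _).mul_pow, ← zpow_natCast, ← zpow_natCast, ← zpow_mul, ← zpow_mul] at hxp
  exact (h.eq_one_iff _ _).1 hxp

/-- The centre of a nontrivial `p`-group contains an element of order `p`. Both of its components
are central by `central_factors`, and one of them is nontrivial, hence generates the subgroup of
order `p` of its factor. -/
lemma central_socle [hp : Fact p.Prime] (h : CyclicFactorization p a b (α + 1) (β + 1)) :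
    (∀ g, Commute (a ^ (p ^ α)) g) ∨ ∀ g, Commute (b ^ (p ^ β)) g := by
  have hc := h.card
  have hfin : Finite P :=
    Nat.finite_of_card_ne_zero (by rw [hc]; exact pow_ne_zero _ hp.out.ne_zero)
  have hP : IsPGroup p P := IsPGroup.of_card hc
  have hnt : Nontrivial P := by
    rw [← Finite.one_lt_card_iff_nontrivial, hc]
    exact Nat.one_lt_pow (by omega) hp.out.one_lt
  have hcent := hP.center_nontrivial
  have hdvd : p ∣ Nat.card (Subgroup.center P) :=
    ((hP.to_subgroup _).card_eq_or_dvd).resolve_left (Finite.one_lt_card_iff_nontrivial.2 hcent).ne'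
  obtain ⟨x, hx⟩ := exists_prime_orderOf_dvd_card' p hdvd
  have hxc : ∀ g, Commute (x : P) g := fun g => ((Subgroup.mem_center_iff.1 x.2) g).symm
  obtain ⟨i, j, hij⟩ := h.exists_eq (x : P)
  have hxp : (x : P) ^ p = 1 := by rw [← hx, ← Subgroup.orderOf_coe, pow_orderOf_eq_one]
  have hx1 : (x : P) ≠ 1 := by
    intro h1
    rw [← Subgroup.orderOf_coe, h1, orderOf_one] at hx
    exact hp.out.one_lt.ne hx
  rw [hij] at hxc hxp hx1
  obtain ⟨d1, d2⟩ := h.central_dvd hxc hxp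
  obtain ⟨c1, c2⟩ := h.central_factors hxc
  by_cases hi : a ^ i = 1
  · right
    intro g
    exact h.symm.commute_socle_of_commute d2
      (fun hj => hx1 (by rw [hi, hj, one_mul])) (c2 g)
  · left
    intro g
    exact h.commute_socle_of_commute d1 hi (c1 g)

end CyclicFactorization

/-! ### The socle of a factorization and the exponent -/

lemma zpow_pow_comm {P : Type*} [Group P] (x : P) (i : ℤ) (n : ℕ) : (x ^ i) ^ n = (x ^ n) ^ i := by
  rw [← zpow_natCast, zpow_comm, zpow_natCast]

namespace CyclicFactorization

lemma commute_socle {P : Type*} [Group P] {p : ℕ} {a b : P} {α β : ℕ} [Fact p.Prime]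
    (h : CyclicFactorization p a b (α + 1) (β + 1)) : Commute (a ^ (p ^ α)) (b ^ (p ^ β)) :=
  h.central_socle.elim (fun h1 => h1 _) fun h1 => (h1 _).symm

lemma quotient_zpowers {P : Type*} [Group P] {p : ℕ} {a b : P} {α β : ℕ}
    (h : CyclicFactorization p a b (α + 1) β) (N : Subgroup P) [N.Normal]
    (hN : N = Subgroup.zpowers (a ^ (p ^ α))) :
    CyclicFactorization p (a : P ⧸ N) (b : P ⧸ N) α β := by
  apply h.quotient
  intro i j
  have e : ∀ k : ℤ, (a ^ (p ^ α)) ^ k = a ^ ((p : ℤ) ^ α * k) * b ^ (0 : ℤ) := by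
    intro k
    rw [zpow_mul, zpow_zero, mul_one, ← zpow_natCast]
    push_cast
    rfl
  rw [hN, Subgroup.mem_zpowers_iff]
  simp only [e, h.eq_iff]
  constructor
  · rintro ⟨k, h1, h2⟩
    refine ⟨?_, by simpa using h2⟩
    have h3 : (p : ℤ) ^ α ∣ (p : ℤ) ^ α * k - i :=
      (pow_dvd_pow _ (Nat.le_succ α)).trans h1
    exact (dvd_sub_right (dvd_mul_right _ _)).1 h3
  · rintro ⟨⟨k, rfl⟩, h2⟩
    exact ⟨k, by simp, by simpa using h2⟩

/-- Normality of the socle. One of the two socle generators is central, say that of `⟨a⟩`. Dividing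
by it, induction puts a conjugate of the other generator into a group slightly too large, and
comparing `p`-th powers cuts it down. Stated over all groups because the induction passes to
quotients. -/
theorem socle_conj {p : ℕ} [hp : Fact p.Prime] (h2 : p ≠ 2) (n : ℕ) :
    ∀ (α β : ℕ) {P : Type*} [Group P] {a b : P}, α + β = n →
      CyclicFactorization p a b (α + 1) (β + 1) → ∀ g : P,
        (∃ k l : ℤ, g * a ^ (p ^ α) * g⁻¹ = (a ^ (p ^ α)) ^ k * (b ^ (p ^ β)) ^ l) ∧
        ∃ k l : ℤ, g * b ^ (p ^ β) * g⁻¹ = (a ^ (p ^ α)) ^ k * (b ^ (p ^ β)) ^ l := by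
  induction n using Nat.strong_induction_on with
  | _ n IH =>
  intro α β P _ a b hn h
  have key : ∀ (α β : ℕ) {a b : P}, α + β = n → CyclicFactorization p a b (α + 1) (β + 1) →
      (∀ g, Commute (a ^ (p ^ α)) g) → ∀ g,
        ∃ k l : ℤ, g * b ^ (p ^ β) * g⁻¹ = (a ^ (p ^ α)) ^ k * (b ^ (p ^ β)) ^ l := by
    clear hn h a b α β
    intro α β a b hn h ha g
    cases α with
    | zero =>
      -- Here `a` itself is central, so the power of `b` commutes with both generators.
      refine ⟨0, 1, ?_⟩
      have h1 : Commute (b ^ (p ^ β)) g := by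
        refine h.commute_of_commute ?_ ((Commute.refl b).pow_left _) g
        simpa using (ha (b ^ (p ^ β))).symm
      rw [h1.symm.mul_inv_cancel]
      simp
    | succ α =>
      set N := Subgroup.zpowers (a ^ (p ^ (α + 1))) with hN
      have hcen : ∀ {x}, x ∈ N → ∀ g, Commute x g := by
        rintro _ ⟨k, rfl⟩ g
        exact (ha g).zpow_left k
      have : N.Normal := ⟨fun x hx g => by rwa [← (hcen hx g).eq, mul_inv_cancel_right]⟩
      have hq := h.quotient_zpowers N hN
      obtain ⟨k, l, hkl⟩ := (IH (α + β) (by omega) α β rfl hq (g : P ⧸ N)).2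
      have hcomm := (hq.commute_socle.zpow_zpow k l).eq
      have hkl' : ((a ^ (p ^ α)) ^ k * (b ^ (p ^ β)) ^ l)⁻¹ * (g * b ^ (p ^ β) * g⁻¹) ∈ N :=
        QuotientGroup.eq.1 hkl.symm
      have hc' : ((a ^ (p ^ α)) ^ k * (b ^ (p ^ β)) ^ l)⁻¹ * ((b ^ (p ^ β)) ^ l * (a ^ (p ^ α)) ^ k)
          ∈ N := QuotientGroup.eq.1 hcomm
      have hNp : ∀ x ∈ N, x ^ p = 1 := by
        rintro _ ⟨k, rfl⟩
        have e : (a ^ (p ^ (α + 1))) ^ p = 1 := by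
          rw [← pow_mul, ← pow_succ, ← zpow_natCast, h.zpow_left_eq_one_iff]
          simp
        simp only
        rw [zpow_pow_comm, e, one_zpow]
      have hb1 : (b ^ (p ^ β)) ^ p = 1 := by
        rw [← pow_mul, ← pow_succ, ← zpow_natCast, h.zpow_right_eq_one_iff]
        simp
      -- The conjugate has order dividing `p`. Modulo `N` it is `(a ^ p ^ α) ^ k * (b ^ p ^ β) ^ l`,
      -- whose two factors commute up to `N`, central of exponent `p`; so its `p`-th power is that
      -- of the first factor. As `a ^ p ^ α` has order `p ^ 2`, this forces `p ∣ k`.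
      have e1 : (a ^ (p ^ α) ) ^ (k * p) = 1 := by
        have f1 := mul_pow_prime_of_central h2 (mul_inv_cancel_left _ _).symm (hcen hc' _)
          (hcen hc' _) (hNp _ hc')
        have f2 : (g * b ^ (p ^ β) * g⁻¹) ^ p = 1 := by
          rw [conj_pow, hb1, mul_one, mul_inv_cancel]
        rw [← mul_inv_cancel_left ((a ^ (p ^ α)) ^ k * (b ^ (p ^ β)) ^ l) (g * b ^ (p ^ β) * g⁻¹),
          ((hcen hkl' _).symm).mul_pow, hNp _ hkl', mul_one, f1, zpow_pow_comm _ l,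
          hb1, one_zpow, mul_one, ← zpow_natCast, ← zpow_mul] at f2
        exact f2
      have hp0 : (p : ℤ) ≠ 0 := by exact_mod_cast hp.out.ne_zero
      rw [← zpow_natCast, ← zpow_mul, h.zpow_left_eq_one_iff, pow_succ, ← mul_assoc,
        mul_dvd_mul_iff_right hp0, pow_succ] at e1
      push_cast at e1
      rw [mul_dvd_mul_iff_left (pow_ne_zero _ hp0)] at e1
      obtain ⟨u, rfl⟩ := e1
      obtain ⟨m, hm⟩ := hkl'
      refine ⟨u + m, l, ?_⟩
      have e2 : (a ^ p ^ α) ^ ((p : ℤ) * u) = (a ^ (p ^ (α + 1))) ^ u := by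
        rw [zpow_mul, zpow_natCast, ← pow_mul, ← pow_succ]
      simp only at hm
      rw [eq_inv_mul_iff_mul_eq, e2] at hm
      rw [← hm, zpow_add, mul_assoc, mul_assoc, (ha _).zpow_left m |>.eq]
  rcases h.central_socle with h1 | h1
  · exact fun g => ⟨⟨1, 0, by rw [← (h1 g).eq]; simp⟩, key α β hn h h1 g⟩
  · intro g
    obtain ⟨k, l, hkl⟩ := key β α (by omega) h.symm h1 g
    exact ⟨⟨l, k, by rw [hkl, (h.commute_socle.zpow_zpow l k).eq]⟩,
      ⟨0, 1, by rw [← (h1 g).eq]; simp⟩⟩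

lemma pow_socle_left {P : Type*} [Group P] {p : ℕ} {a b : P} {α β : ℕ}
    (h : CyclicFactorization p a b (α + 1) β) : (a ^ (p ^ α)) ^ p = 1 := by
  rw [← pow_mul, ← pow_succ, ← h.orderOf_left, pow_orderOf_eq_one]

section Socle

variable {P : Type*} [Group P] {p : ℕ} {a b : P} {α β : ℕ} [hp : Fact p.Prime]

/-- The subgroup generated by the elements of order `p` of the two factors. -/
def socle (h : CyclicFactorization p a b (α + 1) (β + 1)) : Subgroup P := h.commute_socle.span

lemma mem_socle_iff_exists (h : CyclicFactorization p a b (α + 1) (β + 1)) {g : P} :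
    g ∈ h.socle ↔ ∃ i j : ℤ, g = (a ^ (p ^ α)) ^ i * (b ^ (p ^ β)) ^ j := Iff.rfl

lemma socle_normal (h2 : p ≠ 2) (h : CyclicFactorization p a b (α + 1) (β + 1)) :
    h.socle.Normal := by
  refine ⟨?_⟩
  rintro _ ⟨i, j, rfl⟩ g
  obtain ⟨hA, hB⟩ := socle_conj h2 _ α β rfl h g
  have e : g * ((a ^ (p ^ α)) ^ i * (b ^ (p ^ β)) ^ j) * g⁻¹ =
      (g * a ^ (p ^ α) * g⁻¹) ^ i * (g * b ^ (p ^ β) * g⁻¹) ^ j := by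
    rw [conj_zpow, conj_zpow]; group
  rw [e]
  exact mul_mem (zpow_mem (h.mem_socle_iff_exists.2 hA) _)
    (zpow_mem (h.mem_socle_iff_exists.2 hB) _)

lemma mem_socle_iff (h : CyclicFactorization p a b (α + 1) (β + 1)) (i j : ℤ) :
    a ^ i * b ^ j ∈ h.socle ↔ (p : ℤ) ^ α ∣ i ∧ (p : ℤ) ^ β ∣ j := by
  have e : ∀ (x : P) (n : ℕ) (k : ℤ), (x ^ (p ^ n)) ^ k = x ^ ((p : ℤ) ^ n * k) := by
    intro x n k
    rw [zpow_mul, ← zpow_natCast]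
    push_cast
    rfl
  rw [mem_socle_iff_exists]
  simp only [e, h.eq_iff]
  constructor
  · rintro ⟨k, l, h1, h2⟩
    have h3 := (pow_dvd_pow _ (Nat.le_succ α)).trans h1
    have h4 := (pow_dvd_pow _ (Nat.le_succ β)).trans h2
    exact ⟨(dvd_sub_left (dvd_mul_right _ _)).1 h3, (dvd_sub_left (dvd_mul_right _ _)).1 h4⟩
  · rintro ⟨⟨k, rfl⟩, ⟨l, rfl⟩⟩
    exact ⟨k, l, by simp, by simp⟩

lemma quotient_socle (h : CyclicFactorization p a b (α + 1) (β + 1)) [h.socle.Normal] :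
    CyclicFactorization p (a : P ⧸ h.socle) (b : P ⧸ h.socle) α β :=
  h.quotient _ h.mem_socle_iff

lemma pow_eq_one_of_mem_socle (h : CyclicFactorization p a b (α + 1) (β + 1)) {g : P}
    (hg : g ∈ h.socle) : g ^ p = 1 := by
  obtain ⟨i, j, rfl⟩ := hg
  rw [(h.commute_socle.zpow_zpow i j).mul_pow, zpow_pow_comm, zpow_pow_comm,
    h.pow_socle_left, h.symm.pow_socle_left]
  simp

end Socle

/-- The quotient by the socle lowers both exponents by one, and the socle has exponent dividing `p`.
-/
theorem pow_eq_one {p : ℕ} [hp : Fact p.Prime] (h2 : p ≠ 2) (n : ℕ) :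
    ∀ {P : Type*} [Group P] {a b : P}, CyclicFactorization p a b n n → ∀ g : P, g ^ p ^ n = 1 := by
  induction n with
  | zero =>
    intro P _ a b h g
    obtain ⟨i, j, rfl⟩ := h.exists_eq g
    rw [pow_zero, pow_one, h.eq_one_iff]
    simp
  | succ n ih =>
    intro P _ a b h g
    have := h.socle_normal h2
    have h1 := ih h.quotient_socle (g : P ⧸ h.socle)
    rw [← QuotientGroup.mk_pow, QuotientGroup.eq_one_iff] at h1
    rw [pow_succ, pow_mul]
    exact h.pow_eq_one_of_mem_socle h1

end CyclicFactorization

/-! ### Conjugation on cyclic subgroups and splitting by eigenvalues -/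

lemma zpow_eq_zpow_of_dvd_sub {P : Type*} [Group P] {n : ℕ} {y : P} (hy : y ^ n = 1) {i j : ℤ}
    (h : (n : ℤ) ∣ i - j) : y ^ i = y ^ j := by
  obtain ⟨m, hm⟩ := h
  rw [← sub_add_cancel i j, hm, zpow_add, zpow_mul, zpow_natCast, hy, one_zpow, one_mul]

lemma zpow_ne_one_iff_of_prime {P : Type*} [Group P] {p : ℕ} [hp : Fact p.Prime] {y : P}
    (hy : y ^ p = 1) (h1 : y ≠ 1) (i : ℤ) : y ^ i = 1 ↔ (p : ℤ) ∣ i := by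
  rw [← orderOf_dvd_iff_zpow_eq_one, orderOf_eq_prime hy h1]

lemma conj_pow_eq_zpow_pow {P : Type*} [Group P] {g y : P} {j : ℤ} (h : g * y * g⁻¹ = y ^ j)
    (k : ℕ) : g ^ k * y * (g ^ k)⁻¹ = y ^ (j ^ k) := by
  induction k with
  | zero => simp
  | succ k ih =>
    calc g ^ (k + 1) * y * (g ^ (k + 1))⁻¹ = g * (g ^ k * y * (g ^ k)⁻¹) * g⁻¹ := by
          rw [pow_succ']; group
      _ = (g * y * g⁻¹) ^ (j ^ k) := by rw [ih, conj_zpow]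
      _ = _ := by rw [h, ← zpow_mul, pow_succ']

/-- If conjugation by an element of `p`-power order sends an element of order `p` to a power of
itself, then the two elements commute. -/
lemma commute_of_conj_eq_zpow {P : Type*} [Group P] {p : ℕ} [hp : Fact p.Prime] {g y : P} {n : ℕ}
    (hg : g ^ p ^ n = 1) (hy : y ^ p = 1) {j : ℤ} (h : g * y * g⁻¹ = y ^ j) : Commute g y := by
  have h2 := conj_pow_eq_zpow_pow h (p ^ n)
  -- By Fermat, `j ^ p ^ n ≡ j` modulo `p`; since `g ^ p ^ n = 1`, the exponent `j` acts trivially.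
  have h3 : y ^ (j ^ p ^ n) = y ^ j := by
    apply zpow_eq_zpow_of_dvd_sub hy
    rw [← ZMod.intCast_zmod_eq_zero_iff_dvd]
    push_cast
    rw [ZMod.pow_card_pow, sub_self]
  rw [hg, h3, ← h, inv_one, one_mul, mul_one, eq_mul_inv_iff_mul_eq] at h2
  exact h2.symm

/-- In a finite group, a cyclic subgroup that is mapped into itself by an element is mapped into
itself by the powers of that element. -/
lemma zpow_conj_mem_zpowers {P : Type*} [Group P] [Finite P] {g y : P}
    (h : g * y * g⁻¹ ∈ Subgroup.zpowers y) (k : ℤ) :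
    g ^ k * y * (g ^ k)⁻¹ ∈ Subgroup.zpowers y := by
  obtain ⟨j, hj⟩ := h
  obtain ⟨n, hn⟩ := (isOfFinOrder_of_finite g).mem_powers_iff_mem_zpowers.2
    (Subgroup.zpow_mem_zpowers g k)
  simp only at hn
  rw [← hn, conj_pow_eq_zpow_pow hj.symm]
  exact Subgroup.zpow_mem_zpowers _ _

lemma zpowers_normal_of_conj_mem {P : Type*} [Group P] {y : P}
    (h : ∀ g, g * y * g⁻¹ ∈ Subgroup.zpowers y) : (Subgroup.zpowers y).Normal := by
  refine ⟨?_⟩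
  rintro _ ⟨i, rfl⟩ g
  simp only
  rw [← conj_zpow]
  exact zpow_mem (h g) i

lemma mem_normalizer_zpowers_of_conj_mem {P : Type*} [Group P] [Finite P] {g y : P}
    (h : g * y * g⁻¹ ∈ Subgroup.zpowers y) :
    g ∈ Subgroup.normalizer (Subgroup.zpowers y : Set P) := by
  rw [Subgroup.mem_normalizer_iff]
  intro x
  constructor
  · rintro ⟨i, rfl⟩
    simp only
    rw [← conj_zpow]
    exact zpow_mem h i
  · rintro ⟨i, hi⟩
    simp only at hi
    have e : x = (g ^ (-1 : ℤ) * y * (g ^ (-1 : ℤ))⁻¹) ^ i := by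
      rw [conj_zpow, hi]; group
    rw [e]
    exact zpow_mem (zpow_conj_mem_zpowers h (-1)) i

lemma zpow_mul_zpow_of_central {P : Type*} [Group P] {d z t : P} (h : z * d * z⁻¹ = d * t)
    (ht : ∀ g, Commute t g) (i j : ℤ) : z ^ j * d ^ i = d ^ i * z ^ j * t ^ (j * i) := by
  have h1 : d⁻¹ * z * d⁻¹⁻¹ = t * z := by
    rw [mul_inv_eq_iff_eq_mul, ← (ht d).eq] at h
    rw [inv_inv, mul_assoc, h, (ht d).eq]
    group
  have h2 : z ^ j * d * (z ^ j)⁻¹ = d * t ^ j := by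
    have : (d⁻¹ * z * d⁻¹⁻¹) ^ j = (t * z) ^ j := by rw [h1]
    rw [conj_zpow, (ht z).mul_zpow, inv_inv, mul_assoc, inv_mul_eq_iff_eq_mul] at this
    rw [this]
    group
  have h3 : (z ^ j * d * (z ^ j)⁻¹) ^ i = (d * t ^ j) ^ i := by rw [h2]
  rw [conj_zpow, (((ht d).zpow_left j).symm).mul_zpow, ← zpow_mul, mul_inv_eq_iff_eq_mul,
    mul_assoc, ((ht _).zpow_left _).eq, ← mul_assoc] at h3
  exact h3

/-- Splitting off the fixed points of an endomorphism `η`: if `η z₁ = z₁` is central of order `p`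
and `η d = d ^ k z₁ ^ l` with `k ≢ 1` modulo `p`, then `d` can be corrected by a power of `z₁`. -/
lemma exists_corrected {R : Type*} [Group R] {p : ℕ} [hp : Fact p.Prime] {d z₁ : R} (η : R →* R)
    (hc : ∀ g, Commute z₁ g) (hzp : z₁ ^ p = 1) (hz : η z₁ = z₁) {k l : ℤ}
    (hd : η d = d ^ k * z₁ ^ l) (hk : ¬ (p : ℤ) ∣ k - 1) :
    ∃ s : ℤ, η (d * z₁ ^ s) = (d * z₁ ^ s) ^ k := by
  have hco : IsCoprime (p : ℤ) (k - 1) :=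
    (Int.prime_iff_natAbs_prime.2 (by simpa using hp.out)).coprime_iff_not_dvd.2 hk
  obtain ⟨u, v, huv⟩ := hco
  -- The exponent `s` has to solve `l + s ≡ s k`, i.e. `s (k - 1) ≡ l` modulo `p`, and `v` inverts
  -- `k - 1`.
  refine ⟨v * l, ?_⟩
  rw [((hc d).zpow_left (v * l)).symm.mul_zpow, map_mul, map_zpow, hz, hd, mul_assoc, ← zpow_add,
    ← zpow_mul]
  congr 1
  apply zpow_eq_zpow_of_dvd_sub hzp
  exact ⟨l * u, by linear_combination (-l) * huv⟩

/-- A vector that is fixed and also multiplied by `k ≢ 1` is zero. -/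
lemma zpow_eq_one_of_zpow_mul_eq {R : Type*} [Group R] {p : ℕ} [hp : Fact p.Prime] {z₁ : R}
    (hzp : z₁ ^ p = 1) {k n : ℤ} (hk : ¬ (p : ℤ) ∣ k - 1) (h : z₁ ^ (n * k) = z₁ ^ n) :
    z₁ ^ n = 1 := by
  by_cases h1 : z₁ = 1
  · rw [h1, one_zpow]
  · rw [zpow_ne_one_iff_of_prime hzp h1]
    have h2 : z₁ ^ (n * (k - 1)) = 1 := by
      rw [mul_sub, mul_one, zpow_sub, h, mul_inv_cancel]
    rw [zpow_ne_one_iff_of_prime hzp h1] at h2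
    exact ((Int.prime_iff_natAbs_prime.2 (by simpa using hp.out)).dvd_or_dvd h2).resolve_right hk

/-! ### A normal cyclic factor invariant under an operator -/

namespace CyclicFactorization

/-- Descent of the hypothesis that no nontrivial power of `z` is central. -/
lemma quotient_socle_coreFree {P : Type*} [Group P] {p : ℕ} {c z : P} {α β : ℕ} [hp : Fact p.Prime]
    (h : CyclicFactorization p c z (α + 1) (β + 1)) [h.socle.Normal]
    (hc : ∀ g, Commute (c ^ (p ^ α)) g)
    (hz : ∀ i : ℤ, (∀ g, Commute (z ^ i) g) → z ^ i = 1) (i : ℤ)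
    (hi : ∀ g, Commute ((z : P ⧸ h.socle) ^ i) g) : (z : P ⧸ h.socle) ^ i = 1 := by
  have key : ∀ g : P, Commute (z ^ (i * p)) g := by
    intro g
    have h1 : (z ^ i)⁻¹ * (g * z ^ i * g⁻¹) ∈ h.socle := by
      apply QuotientGroup.eq.1
      have := (hi g).eq
      rw [QuotientGroup.mk_mul, QuotientGroup.mk_mul, QuotientGroup.mk_zpow, ← this]
      simp
    -- The commutator lies in the socle, generated by a central element and a power of `z`, so it
    -- commutes with `z ^ i`. Taking `p`-th powers then kills it, and `z ^ (i * p)` is central.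
    have h2 : Commute (z ^ i) ((z ^ i)⁻¹ * (g * z ^ i * g⁻¹)) := by
      obtain ⟨k, l, hkl⟩ := h1
      rw [hkl]
      exact ((hc _).symm.zpow_right k).mul_right
        ((((Commute.refl z).zpow_left i).pow_right _).zpow_right _)
    have h3 := h2.mul_pow p
    rw [mul_inv_cancel_left, h.pow_eq_one_of_mem_socle h1, mul_one, conj_pow] at h3
    rw [zpow_mul, zpow_natCast]
    exact (mul_inv_eq_iff_eq_mul.1 h3).symm
  have h1 := hz _ key
  rw [h.zpow_right_eq_one_iff, pow_succ, mul_dvd_mul_iff_right] at h1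
  · exact (h.quotient_socle.zpow_right_eq_one_iff i).2 h1
  · exact_mod_cast hp.out.ne_zero

/-- If `c`, of order `p ^ (m + 2)`, is a product of powers of `d`, of `z` and of a central element
`x` of order `p`, and `z` acts on `d` as the `k`-th power modulo `⟨x⟩` with `k ≡ 1` modulo `p`, then
`d ^ p ^ (m + 1) ≠ 1`. -/
lemma pow_ne_one_of_factorization {P : Type*} [Group P] {p : ℕ} [hp : Fact p.Prime] (h2 : p ≠ 2)
    {c z : P} {m β : ℕ} (h : CyclicFactorization p c z (m + 2) β) {d x : P}
    (hx : ∀ g, Commute x g) (hxp : x ^ p = 1)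
    (hgen : ∃ i j l : ℤ, c = d ^ i * z ^ j * x ^ l) {k n : ℤ}
    (hzd : z * d * z⁻¹ = d ^ k * x ^ n) (hk : (p : ℤ) ∣ k - 1) : d ^ p ^ (m + 1) ≠ 1 := by
  have hfin : Finite P :=
    Nat.finite_of_card_ne_zero (by rw [h.card]; exact pow_ne_zero _ hp.out.ne_zero)
  intro hd
  obtain ⟨v, hv⟩ := hk
  have hxn : ∀ r : ℕ, (x ^ n) ^ p ^ (r + 1) = 1 := by
    intro r
    rw [zpow_pow_comm, pow_succ', pow_mul, hxp, one_pow, one_zpow]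
  -- Raising to a `p`-th power removes `x`; the congruence `k ≡ 1` makes `z` centralize `d ^ p ^ (r
  -- + 1)` modulo the next power.
  have hzdr : ∀ r : ℕ, z * d ^ p ^ (r + 1) * z⁻¹ = d ^ p ^ (r + 1) * (d ^ p ^ (r + 2)) ^ v := by
    intro r
    rw [← conj_pow, hzd, (((hx _).zpow_left _).symm).mul_pow, hxn r, mul_one, ← zpow_natCast,
      ← zpow_natCast, ← zpow_natCast, ← zpow_mul, ← zpow_mul, ← zpow_add]
    congr 1
    push_cast
    linear_combination ((p : ℤ) ^ (r + 1)) * hv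
  have hN : ∀ r : ℕ, (Subgroup.zpowers (d ^ p ^ (r + 1))).Normal := by
    intro r
    rw [← Subgroup.normalizer_eq_top_iff, Subgroup.eq_top_iff']
    have hz' : z ∈ Subgroup.normalizer (Subgroup.zpowers (d ^ p ^ (r + 1)) : Set P) := by
      apply mem_normalizer_zpowers_of_conj_mem
      rw [hzdr, pow_succ p (r + 1), pow_mul]
      exact mul_mem (Subgroup.mem_zpowers _) (zpow_mem (Subgroup.npow_mem_zpowers _ _) _)
    have hd' : d ∈ Subgroup.normalizer (Subgroup.zpowers (d ^ p ^ (r + 1)) : Set P) := by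
      apply mem_normalizer_zpowers_of_conj_mem
      rw [((Commute.refl d).pow_right _).mul_inv_cancel]
      exact Subgroup.mem_zpowers _
    have hx' : x ∈ Subgroup.normalizer (Subgroup.zpowers (d ^ p ^ (r + 1)) : Set P) := by
      apply mem_normalizer_zpowers_of_conj_mem
      rw [(hx _).mul_inv_cancel]
      exact Subgroup.mem_zpowers _
    have hc' : c ∈ Subgroup.normalizer (Subgroup.zpowers (d ^ p ^ (r + 1)) : Set P) := by
      obtain ⟨i, j, l, hc⟩ := hgen
      rw [hc]
      exact mul_mem (mul_mem (zpow_mem hd' _) (zpow_mem hz' _)) (zpow_mem hx' _)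
    intro g
    obtain ⟨i, j, rfl⟩ := h.exists_eq g
    exact mul_mem (zpow_mem hc' _) (zpow_mem hz' _)
  -- Powers of `c` are computed modulo `⟨d ^ p ^ (r + 1)⟩`. For `r = 0` the commutator of `z` and
  -- `d` is the central element `x ^ n` of order dividing `p`; later the relevant power of `d`
  -- commutes with `z` and is killed by `p`.
  have key : ∀ r : ℕ, ∃ i j : ℤ, c ^ p ^ (r + 1) = (d ^ p ^ (r + 1)) ^ i * z ^ j := by
    intro r
    induction r with
    | zero =>
      have := hN 0
      obtain ⟨i, j, l, hc⟩ := hgen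
      set N := Subgroup.zpowers (d ^ p ^ (0 + 1)) with hNdef
      have hdN : (d : P ⧸ N) ^ p = 1 := by
        rw [← QuotientGroup.mk_pow, QuotientGroup.eq_one_iff, hNdef, zero_add, pow_one]
        exact Subgroup.mem_zpowers _
      have hxN : ∀ g, Commute (x : P ⧸ N) g := by
        intro g
        obtain ⟨g, rfl⟩ := QuotientGroup.mk_surjective g
        exact congrArg (QuotientGroup.mk (s := N)) (hx g).eq
      have hxpN : (x : P ⧸ N) ^ p = 1 := by rw [← QuotientGroup.mk_pow, hxp, QuotientGroup.mk_one]
      have hzdN : (z : P ⧸ N) * d * (z : P ⧸ N)⁻¹ = d * (x : P ⧸ N) ^ n := by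
        have := congrArg (QuotientGroup.mk (s := N)) hzd
        rw [QuotientGroup.mk_mul, QuotientGroup.mk_mul, QuotientGroup.mk_mul, QuotientGroup.mk_inv,
          QuotientGroup.mk_zpow, QuotientGroup.mk_zpow] at this
        rw [this, zpow_eq_zpow_of_dvd_sub hdN ⟨v, hv⟩, zpow_one]
      have e1 := zpow_mul_zpow_of_central hzdN (fun g => (hxN g).zpow_left n) i j
      have e2 := mul_pow_prime_of_central h2 e1 (((hxN _).zpow_left n).zpow_left _)
        (((hxN _).zpow_left n).zpow_left _)
        (by rw [zpow_pow_comm, zpow_pow_comm, hxpN, one_zpow, one_zpow])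
      have e3 : (c : P ⧸ N) ^ p = (z : P ⧸ N) ^ (j * p) := by
        rw [hc, QuotientGroup.mk_mul, QuotientGroup.mk_mul, QuotientGroup.mk_zpow,
          QuotientGroup.mk_zpow, QuotientGroup.mk_zpow, (((hxN _).zpow_left l).symm).mul_pow, e2,
          zpow_pow_comm, zpow_pow_comm _ l, hdN, hxpN, one_zpow, one_zpow, one_mul, mul_one,
          zpow_mul, zpow_natCast]
      rw [← QuotientGroup.mk_pow, ← QuotientGroup.mk_zpow, QuotientGroup.eq_iff_div_mem] at e3
      obtain ⟨u, hu⟩ := e3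
      exact ⟨u, j * p, by rw [zero_add, pow_one] at hu ⊢; exact div_eq_iff_eq_mul.1 hu.symm⟩
    | succ r ih =>
      have := hN (r + 1)
      obtain ⟨i, j, hc⟩ := ih
      set N := Subgroup.zpowers (d ^ p ^ (r + 1 + 1)) with hNdef
      have hmem : d ^ p ^ (r + 2) ∈ N := Subgroup.mem_zpowers _
      have hdN : ((d ^ p ^ (r + 1) : P) : P ⧸ N) ^ p = 1 := by
        rw [← QuotientGroup.mk_pow, QuotientGroup.eq_one_iff, ← pow_mul, ← pow_succ]
        exact hmem
      have hzdN : Commute (z : P ⧸ N) (d ^ p ^ (r + 1) : P) := by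
        have := congrArg (QuotientGroup.mk (s := N)) (hzdr r)
        rw [QuotientGroup.mk_mul, QuotientGroup.mk_mul, QuotientGroup.mk_mul, QuotientGroup.mk_inv,
          QuotientGroup.mk_zpow, (QuotientGroup.eq_one_iff (N := N) _).2 hmem, one_zpow, mul_one,
          mul_inv_eq_iff_eq_mul] at this
        exact this
      have e3 : (c : P ⧸ N) ^ p ^ (r + 2) = (z : P ⧸ N) ^ (j * p) := by
        rw [pow_succ, pow_mul, ← QuotientGroup.mk_pow, hc, QuotientGroup.mk_mul,
          QuotientGroup.mk_zpow, QuotientGroup.mk_zpow, ((hzdN.zpow_zpow j i).symm).mul_pow,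
          zpow_pow_comm, hdN, one_zpow, one_mul, zpow_mul, zpow_natCast]
      rw [← QuotientGroup.mk_pow, ← QuotientGroup.mk_zpow, QuotientGroup.eq_iff_div_mem] at e3
      obtain ⟨u, hu⟩ := e3
      exact ⟨u, j * p, div_eq_iff_eq_mul.1 hu.symm⟩
  -- If `d ^ p ^ (m + 1) = 1`, then `c ^ p ^ (m + 1)` is a power of `z`, hence trivial, against the
  -- order of `c`.
  obtain ⟨i, j, hij⟩ := key m
  rw [hd, one_zpow, one_mul, ← mul_inv_eq_one, ← zpow_natCast, ← zpow_neg, h.eq_one_iff] at hij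
  have h3 : p ^ (m + 2) ∣ p ^ (m + 1) := by exact_mod_cast hij.1
  have := (Nat.pow_dvd_pow_iff_le_right hp.out.one_lt).1 h3
  omega

end CyclicFactorization

lemma zpow_pow_natCast {P : Type*} [Group P] (x : P) (p n : ℕ) (k : ℤ) :
    (x ^ p ^ n) ^ k = x ^ ((p : ℤ) ^ n * k) := by
  rw [zpow_mul, ← zpow_natCast]
  push_cast
  rfl

/-- If `η d = d ^ k` and `w = d ^ i z₁ ^ n` also satisfies `η w = w ^ k`, then `z₁ ^ n = 1`. -/
lemma zpow_eq_one_of_map_eq_zpow {R : Type*} [Group R] {p : ℕ} [hp : Fact p.Prime] {d z₁ w : R}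
    (η : R →* R) (hc : ∀ g, Commute z₁ g) (hzp : z₁ ^ p = 1) (hz : η z₁ = z₁) {k i n : ℤ}
    (hk : ¬ (p : ℤ) ∣ k - 1) (hd : η d = d ^ k) (hw : η w = w ^ k) (h : w = d ^ i * z₁ ^ n) :
    z₁ ^ n = 1 := by
  apply zpow_eq_one_of_zpow_mul_eq hzp hk
  rw [h, map_mul, map_zpow, map_zpow, hz, hd, (((hc _).zpow_left n).symm).mul_zpow, zpow_comm,
    ← zpow_mul z₁] at hw
  exact (mul_left_cancel hw).symm

namespace CyclicFactorization

/-- Lifts a good factor from the socle quotient. The order of `d` grows by a factor `p` because `d ^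
p ^ (m + 1)` is nontrivial (`pow_ne_one_of_factorization`), hence generates `⟨c ^ p ^ (m + 1)⟩`. So
the error term in the conjugation by `z` is itself a power of `d`. -/
lemma of_quotient_socle {P : Type*} [Group P] {p : ℕ} [hp : Fact p.Prime] (h2 : p ≠ 2)
    {c z d : P} {m β : ℕ} (h : CyclicFactorization p c z (m + 2) (β + 1)) [h.socle.Normal]
    (hx : ∀ g, Commute (c ^ p ^ (m + 1)) g)
    (hd : CyclicFactorization p (d : P ⧸ h.socle) (z : P ⧸ h.socle) (m + 1) β) {s n u : ℤ}
    (hzd : z * d * z⁻¹ = d ^ s * (c ^ p ^ (m + 1)) ^ n) (hs : (p : ℤ) ∣ s - 1)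
    (hu : d ^ p ^ (m + 1) = (c ^ p ^ (m + 1)) ^ u) :
    CyclicFactorization p d z (m + 2) (β + 1) ∧ c ^ p ^ (m + 1) ∈ Subgroup.zpowers d ∧
      ∀ g, g * d * g⁻¹ ∈ Subgroup.zpowers d := by
  have hfin : Finite P :=
    Nat.finite_of_card_ne_zero (by rw [h.card]; exact pow_ne_zero _ hp.out.ne_zero)
  have hp0 : (p : ℤ) ≠ 0 := by exact_mod_cast hp.out.ne_zero
  have hpp : Prime (p : ℤ) := Int.prime_iff_natAbs_prime.2 (by simpa using hp.out)
  have hgen : ∀ g : P, ∃ i j l : ℤ, g = d ^ i * z ^ j * (c ^ p ^ (m + 1)) ^ l := by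
    intro g
    obtain ⟨i, j, hij⟩ := hd.exists_eq (g : P ⧸ h.socle)
    obtain ⟨l, n, hln⟩ : (d ^ i * z ^ j)⁻¹ * g ∈ h.socle := QuotientGroup.eq.1 hij.symm
    refine ⟨i, j + (p : ℤ) ^ β * n, l, ?_⟩
    rw [inv_mul_eq_iff_eq_mul] at hln
    rw [hln, ((hx _).zpow_left l).eq, zpow_add, zpow_pow_natCast z]
    simp only [mul_assoc]
  have hxp := h.pow_socle_left
  have hne := h.pow_ne_one_of_factorization h2 hx hxp (hgen c) hzd hs
  have hx1 : c ^ p ^ (m + 1) ≠ 1 := by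
    intro h1
    rw [hu, h1, one_zpow] at hne
    exact hne rfl
  rw [hu, Ne, zpow_ne_one_iff_of_prime hxp hx1] at hne
  obtain ⟨v, w, hvw⟩ := hpp.coprime_iff_not_dvd.2 hne
  -- The exponent `w` is an inverse of `u` modulo `p`.
  have hxd : c ^ p ^ (m + 1) = d ^ ((p : ℤ) ^ (m + 1) * w) := by
    rw [← zpow_pow_natCast, hu, ← zpow_mul]
    conv_lhs => rw [← zpow_one (c ^ p ^ (m + 1))]
    exact zpow_eq_zpow_of_dvd_sub hxp ⟨v, by linear_combination -hvw⟩
  have hxmem : c ^ p ^ (m + 1) ∈ Subgroup.zpowers d := by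
    rw [hxd]
    exact Subgroup.zpow_mem_zpowers _ _
  have hcf : CyclicFactorization p d z (m + 2) (β + 1) := by
    refine ⟨fun g => ?_, fun i j => ?_⟩
    · obtain ⟨i, j, l, hg⟩ := hgen g
      refine ⟨i + (p : ℤ) ^ (m + 1) * w * l, j, ?_⟩
      rw [zpow_add, zpow_mul _ (_ * _), ← hxd, hg, mul_assoc, mul_assoc, ((hx _).zpow_left l).eq]
    · have e : ∀ i' : ℤ, d ^ ((p : ℤ) ^ (m + 1) * i') = c ^ ((p : ℤ) ^ (m + 1) * (u * i')) := by
        intro i'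
        rw [← zpow_pow_natCast, hu, ← zpow_mul, zpow_pow_natCast]
      constructor
      · intro e1
        have e2 : (d : P ⧸ h.socle) ^ i * (z : P ⧸ h.socle) ^ j = 1 := by
          rw [← QuotientGroup.mk_zpow, ← QuotientGroup.mk_zpow, ← QuotientGroup.mk_mul, e1,
            QuotientGroup.mk_one]
        obtain ⟨i', rfl⟩ := ((hd.eq_one_iff i j).1 e2).1
        rw [e, h.eq_one_iff, pow_succ _ (m + 1),
          mul_dvd_mul_iff_left (pow_ne_zero _ hp0)] at e1
        rw [pow_succ _ (m + 1), mul_dvd_mul_iff_left (pow_ne_zero _ hp0)]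
        exact ⟨(hpp.dvd_or_dvd e1.1).resolve_left hne, e1.2⟩
      · rintro ⟨⟨i', rfl⟩, hj⟩
        rw [pow_succ _ (m + 1), mul_assoc, e, h.eq_one_iff]
        exact ⟨⟨u * i', by ring⟩, hj⟩
  refine ⟨hcf, hxmem, fun g => ?_⟩
  have hz' : z ∈ Subgroup.normalizer (Subgroup.zpowers d : Set P) := by
    apply mem_normalizer_zpowers_of_conj_mem
    rw [hzd]
    exact mul_mem (Subgroup.zpow_mem_zpowers _ _) (zpow_mem hxmem _)
  have hd' : d ∈ Subgroup.normalizer (Subgroup.zpowers d : Set P) := by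
    apply mem_normalizer_zpowers_of_conj_mem
    rw [mul_inv_cancel_right]
    exact Subgroup.mem_zpowers _
  have hg : g ∈ Subgroup.normalizer (Subgroup.zpowers d : Set P) := by
    obtain ⟨i, j, rfl⟩ := hcf.exists_eq g
    exact mul_mem (zpow_mem hd' _) (zpow_mem hz' _)
  exact (Subgroup.mem_normalizer_iff.1 hg d).1 (Subgroup.mem_zpowers d)

lemma normal_zpowers_of_central {P : Type*} [Group P] {x : P} (hx : ∀ g, Commute x g) :
    (Subgroup.zpowers x).Normal :=
  zpowers_normal_of_conj_mem fun g => by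
    rw [← (hx g).eq, mul_inv_cancel_right]
    exact Subgroup.mem_zpowers x

/-- Induction on the length of `⟨z⟩`, through the quotient by the socle. The character `χ` kills the
socle and so descends; it records that `η` acts on the top of `⟨c⟩` with eigenvalue `k ≢ 1`, whereas
`η` fixes `z`. Core-freeness of `⟨z⟩` descends by `quotient_socle_coreFree` and forces the socle of
`⟨c⟩` to be central. -/
theorem exists_normal_factor {p : ℕ} [hp : Fact p.Prime] (h2 : p ≠ 2) {Q : Type*} [CommGroup Q]
    (hQ : ∀ x : Q, x ^ p = 1) {k : ℤ} (hk : ¬ (p : ℤ) ∣ k - 1) (β : ℕ) :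
    ∀ (α : ℕ) {P : Type*} [Group P] {c z : P} (_ : CyclicFactorization p c z α β)
      (_ : ∀ i : ℤ, (∀ g, Commute (z ^ i) g) → z ^ i = 1)
      (η : P →* P) (_ : Function.Surjective η) (_ : η z = z)
      (χ : P →* Q) (_ : χ z = 1) (_ : χ c ≠ 1) (_ : ∀ g, χ (η g) = χ g ^ k),
      ∃ d : P, CyclicFactorization p d z α β ∧ (∀ g, g * d * g⁻¹ ∈ Subgroup.zpowers d) ∧
        η d ∈ Subgroup.zpowers d := by
  induction β with
  | zero =>
    intro α P _ c z h _ η _ _ χ _ _ _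
    have hall : ∀ g, g ∈ Subgroup.zpowers c := by
      intro g
      obtain ⟨i, j, rfl⟩ := h.exists_eq g
      rw [(h.zpow_right_eq_one_iff j).2 (by simp), mul_one]
      exact Subgroup.zpow_mem_zpowers _ _
    exact ⟨c, h, fun g => hall _, hall _⟩
  | succ β ih =>
    intro α P _ c z h hz η hη hηz χ hχz hχc hχη
    have hp0 : (p : ℤ) ≠ 0 := by exact_mod_cast hp.out.ne_zero
    have hzc : ¬ ∀ g, Commute (z ^ p ^ β) g := by
      intro h1
      have h3 := hz (p ^ β : ℕ) (fun g => by rw [zpow_natCast]; exact h1 g)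
      rw [h.zpow_right_eq_one_iff] at h3
      have h4 : p ^ (β + 1) ∣ p ^ β := by exact_mod_cast h3
      have := (Nat.pow_dvd_pow_iff_le_right hp.out.one_lt).1 h4
      omega
    -- Short `⟨c⟩` is impossible: `c = 1` contradicts `χ c ≠ 1`, and if `c` has order `p` then the
    -- socle of `⟨z⟩` is central in either case of `central_socle`.
    rcases α with _ | _ | m
    · have : c = 1 := by simpa using (h.zpow_left_eq_one_iff 1).2 (by simp)
      rw [this, map_one] at hχc
      exact absurd rfl hχc
    · exfalso
      refine hzc (h.central_socle.elim (fun h1 g => ?_) id)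
      rw [pow_zero, pow_one] at h1
      exact h.commute_of_commute (h1 _).symm ((Commute.refl z).pow_left _) g
    have hx := h.central_socle.resolve_right hzc
    have hxp := h.pow_socle_left
    have hzp := h.symm.pow_socle_left
    have hEn := h.socle_normal h2
    set x := c ^ p ^ (m + 1) with hxdef
    set z₁ := z ^ p ^ β with hzdef
    -- By surjectivity `η x` is central, so its `z`-component is central, hence trivial; what
    -- remains is an element of `⟨c⟩` killed by `p`.
    obtain ⟨u, hηx⟩ : ∃ u : ℤ, η x = x ^ u := by
      have hcen : ∀ g, Commute (η x) g := by
        intro g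
        obtain ⟨g, rfl⟩ := hη g
        exact (hx g).map η
      have hpw : η x ^ p = 1 := by rw [← map_pow, hxp, map_one]
      obtain ⟨i, j, hij⟩ := h.exists_eq (η x)
      rw [hij] at hcen hpw
      have h3 := (h.central_dvd hcen hpw).1
      rw [hz j (h.central_factors hcen).2, mul_one] at hij
      rw [pow_succ, mul_dvd_mul_iff_right hp0] at h3
      obtain ⟨u, rfl⟩ := h3
      exact ⟨u, by rw [hij, hxdef, zpow_pow_natCast]⟩
    have hηz₁ : η z₁ = z₁ := by rw [map_pow, hηz]
    have hE : h.socle ≤ h.socle.comap η := by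
      rintro _ ⟨i, j, rfl⟩
      rw [Subgroup.mem_comap, map_mul, map_zpow, map_zpow, hηz₁, hηx, ← zpow_mul]
      exact ⟨_, _, rfl⟩
    have hχx : χ x = 1 := by rw [map_pow, pow_succ', pow_mul, hQ, one_pow]
    have hχz₁ : χ z₁ = 1 := by rw [map_pow, hχz, one_pow]
    have hχE : ∀ g ∈ h.socle, χ g = 1 := by
      rintro _ ⟨i, j, rfl⟩
      rw [map_mul, map_zpow, map_zpow, hχx, hχz₁, one_zpow, one_zpow, mul_one]
    obtain ⟨d, hd, hdn, hdη⟩ := ih (m + 1) h.quotient_socle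
      (h.quotient_socle_coreFree hx hz) (QuotientGroup.map _ _ η hE)
      (by
        intro g
        obtain ⟨g, rfl⟩ := QuotientGroup.mk_surjective g
        obtain ⟨g, rfl⟩ := hη g
        exact ⟨g, rfl⟩)
      (congrArg QuotientGroup.mk hηz) (QuotientGroup.lift h.socle χ hχE) hχz hχc
      (by
        intro g
        obtain ⟨g, rfl⟩ := QuotientGroup.mk_surjective g
        exact hχη g)
    obtain ⟨d, rfl⟩ := QuotientGroup.mk_surjective d
    have hχd : χ d ≠ 1 := by
      intro h1
      obtain ⟨i, j, hij⟩ := hd.exists_eq (c : P ⧸ h.socle)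
      have := congrArg (QuotientGroup.lift h.socle χ hχE) hij
      rw [map_mul, map_zpow, map_zpow] at this
      change χ c = χ d ^ i * χ z ^ j at this
      rw [h1, hχz, one_zpow, one_zpow, mul_one] at this
      exact hχc this
    have hpow : ∀ g : P, g ^ p ^ (m + 2 + (β + 1)) = 1 := by
      intro g
      rw [← h.card, pow_card_eq_one']
    -- the quotient by the central subgroup of order `p`
    have hXn := normal_zpowers_of_central hx
    set X := Subgroup.zpowers x with hXdef
    have hX : X ≤ X.comap η := by
      rintro _ ⟨i, rfl⟩
      simp only
      rw [Subgroup.mem_comap, map_zpow, hηx, ← zpow_mul]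
      exact Subgroup.zpow_mem_zpowers _ _
    set θ := QuotientGroup.map X X η hX with hθ
    have hθmk : ∀ g : P, θ (g : P ⧸ X) = (η g : P) := fun g => rfl
    have hxX : (x : P ⧸ X) = 1 := (QuotientGroup.eq_one_iff _).2 (Subgroup.mem_zpowers x)
    have hzpX : (z₁ : P ⧸ X) ^ p = 1 := by rw [← QuotientGroup.mk_pow, hzp, QuotientGroup.mk_one]
    -- Modulo `X` the socle is `⟨z₁⟩`, which is therefore normal of order dividing `p`, and a
    -- `p`-group acts trivially on it.
    have hzX : ∀ g, Commute (z₁ : P ⧸ X) g := by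
      intro g
      obtain ⟨g, rfl⟩ := QuotientGroup.mk_surjective g
      obtain ⟨i, j, hij⟩ := (socle_conj h2 _ (m + 1) β rfl h g).2
      have e := congrArg (QuotientGroup.mk (s := X)) hij
      rw [QuotientGroup.mk_mul, QuotientGroup.mk_mul, QuotientGroup.mk_mul, QuotientGroup.mk_inv,
        QuotientGroup.mk_zpow, QuotientGroup.mk_zpow, hxX, one_zpow, one_mul] at e
      refine (commute_of_conj_eq_zpow (n := m + 2 + (β + 1)) ?_ hzpX e).symm
      rw [← QuotientGroup.mk_pow, hpow, QuotientGroup.mk_one]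
    have hθz : θ (z₁ : P ⧸ X) = z₁ := by rw [hθmk, hηz₁]
    obtain ⟨k', hk'⟩ := hdη
    obtain ⟨i, l, hil⟩ : (d ^ k')⁻¹ * η d ∈ h.socle := QuotientGroup.eq.1 hk'
    rw [inv_mul_eq_iff_eq_mul] at hil
    -- Evaluating `χ` on `η d`, with `χ d ≠ 1`, gives `k' ≡ k` modulo `p`.
    have hkk : ¬ (p : ℤ) ∣ k' - 1 := by
      have e := hχη d
      rw [hil, map_mul, hχE _ ⟨i, l, rfl⟩, mul_one, map_zpow, ← mul_inv_eq_one, ← zpow_sub,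
        zpow_ne_one_iff_of_prime (hQ _) hχd] at e
      intro h3
      apply hk
      have := dvd_sub h3 e
      rwa [sub_sub_sub_cancel_left] at this
    -- The lift `d` is an eigenvector of `η` modulo `X` only up to a power of `z₁`; multiplying `d`
    -- by a power of `z₁` makes it exact.
    obtain ⟨s, hs⟩ := exists_corrected (d := (d : P ⧸ X)) θ hzX hzpX hθz (k := k') (l := l) (by
      rw [hθmk, hil, QuotientGroup.mk_mul, QuotientGroup.mk_mul, QuotientGroup.mk_zpow,
        QuotientGroup.mk_zpow, QuotientGroup.mk_zpow, hxX, one_zpow, one_mul]) hkk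
    have hdE : (d : P ⧸ h.socle) = (d * z₁ ^ s : P) := by
      apply QuotientGroup.eq.2
      rw [inv_mul_cancel_left]
      exact ⟨0, s, by simp [hzdef]⟩
    have hχd' : χ (d * z₁ ^ s) ≠ 1 := by
      rwa [map_mul, map_zpow, hχz₁, one_zpow, mul_one]
    have hs' : θ ((d * z₁ ^ s : P) : P ⧸ X) = ((d * z₁ ^ s : P) : P ⧸ X) ^ k' := hs
    rw [hdE] at hd hdn
    clear hs hdE hil hk' hχd
    generalize d * z₁ ^ s = d at hd hdn hs' hχd'
    -- Modulo `X`, an element of `⟨d⟩⟨z₁⟩` on which `η` acts as the `k'`-th power has no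
    -- `z₁`-component. This applies to `z * d * z⁻¹`, because `η` fixes `z`, and to `1`, which turns
    -- `d ^ p ^ (m + 1)` in the socle into a power of `x`.
    have hvanish : ∀ (w : P) (i n l : ℤ), θ (w : P ⧸ X) = (w : P ⧸ X) ^ k' →
        w = d ^ i * (x ^ l * z₁ ^ n) → (d ^ i)⁻¹ * w ∈ X := by
      intro w i n l hw hwe
      have e : (w : P ⧸ X) = (d : P ⧸ X) ^ i * (z₁ : P ⧸ X) ^ n := by
        rw [hwe, QuotientGroup.mk_mul, QuotientGroup.mk_mul, QuotientGroup.mk_zpow,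
          QuotientGroup.mk_zpow, QuotientGroup.mk_zpow, hxX, one_zpow, one_mul]
      apply QuotientGroup.eq.1
      rw [e, zpow_eq_one_of_map_eq_zpow θ hzX hzpX hθz hkk hs' hw e, mul_one,
        QuotientGroup.mk_zpow]
    obtain ⟨t, ht⟩ := hdn z
    obtain ⟨l, n, hln⟩ : (d ^ t)⁻¹ * (z * d * z⁻¹) ∈ h.socle := QuotientGroup.eq.1 ht
    obtain ⟨n', hn'⟩ := hvanish (z * d * z⁻¹) t n l (by
      rw [hθmk, map_mul, map_mul, map_inv, hηz, QuotientGroup.mk_mul, QuotientGroup.mk_mul,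
        ← hθmk, hs', QuotientGroup.mk_mul, QuotientGroup.mk_mul, QuotientGroup.mk_inv, conj_zpow])
      (inv_mul_eq_iff_eq_mul.1 hln)
    have hzd : z * d * z⁻¹ = d ^ t * x ^ n' := (inv_mul_eq_iff_eq_mul.1 hn'.symm)
    obtain ⟨l', n₂, hln'⟩ : d ^ p ^ (m + 1) ∈ h.socle := by
      rw [← QuotientGroup.eq_one_iff, QuotientGroup.mk_pow, ← zpow_natCast,
        hd.zpow_left_eq_one_iff]
      simp
    obtain ⟨u', hu'⟩ := hvanish 1 (-(p ^ (m + 1) : ℕ)) n₂ l' (by simp)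
      (by rw [← hzdef, ← hxdef] at hln'; rw [← hln', zpow_neg, zpow_natCast, inv_mul_cancel])
    have hu : d ^ p ^ (m + 1) = x ^ u' := by
      simp only [zpow_neg, inv_inv, mul_one, zpow_natCast] at hu'
      exact hu'.symm
    -- Since `χ z = 1`, conjugation by `z` does not change `χ d`.
    have ht1 : (p : ℤ) ∣ t - 1 := by
      have e := congrArg χ hzd
      rw [map_mul, map_mul, map_inv, hχz, map_mul, map_zpow, map_zpow, hχx, one_zpow, mul_one,
        one_mul, inv_one, mul_one] at e
      rw [← zpow_ne_one_iff_of_prime (hQ _) hχd', zpow_sub, zpow_one, ← e, mul_inv_cancel]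
    obtain ⟨r1, r2, r3⟩ := h.of_quotient_socle h2 hx hd hzd ht1 hu
    refine ⟨d, r1, r3, ?_⟩
    obtain ⟨y, hy⟩ : (d ^ k')⁻¹ * η d ∈ X := QuotientGroup.eq.1 hs'.symm
    rw [inv_mul_eq_iff_eq_mul.1 hy.symm]
    exact mul_mem (Subgroup.zpow_mem_zpowers _ _) (zpow_mem r2 y)

end CyclicFactorization

/-- An exponent prime to the even number `N` is odd, so it fixes `a ^ (N / 2)`, whose square is `1`.
Hence replacing `a` by another generator of `⟨a⟩` does not disturb `b`. -/
lemma pow_half_of_coprime {G : Type*} [Group G] {a : G} {N t : ℕ} (ha : a ^ N = 1) (hN : 2 ∣ N)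
    (ht : Nat.Coprime t N) : (a ^ t) ^ (N / 2) = a ^ (N / 2) := by
  obtain ⟨n, rfl⟩ := hN
  obtain ⟨w, rfl⟩ := (Nat.Coprime.coprime_mul_right_right ht).symm.odd_of_left
  have h3 : (2 * w + 1) * n = 2 * n * w + n := by ring
  rw [Nat.mul_div_cancel_left n two_pos, ← pow_mul, h3, pow_add, pow_mul, ha, one_pow, one_mul]

/-! ### Recognition of `G₁(p, e)` as a semidirect product -/

namespace G1

variable {p e : ℕ} [hp : Fact p.Prime]

lemma card_pos (p e : ℕ) [hp : Fact p.Prime] : 0 < p ^ e * (p - 1) :=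
  Nat.mul_pos (pow_pos hp.out.pos e) (Nat.sub_pos_of_lt hp.out.one_lt)

lemma conj_pow_unit {G : Type*} [Group G] {M : ℕ} {a f : G} (hf : f ^ M = 1)
    {σ : (ZMod M)ˣ} [NeZero M] (h : a⁻¹ * f * a = f ^ (σ : ZMod M).val) (n : ℕ) :
    (a ^ n)⁻¹ * f * a ^ n = f ^ ((σ ^ n : (ZMod M)ˣ) : ZMod M).val := by
  have hcong : ∀ {m n : ℕ}, (m : ZMod M) = n → f ^ m = f ^ n := fun h =>
    pow_eq_pow_of_modEq ((ZMod.natCast_eq_natCast_iff _ _ _).1 h) hf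
  induction n with
  | zero =>
    rw [pow_zero, pow_zero, inv_one, one_mul, mul_one]
    conv_lhs => rw [← pow_one f]
    apply hcong
    simp
  | succ n ih =>
    calc (a ^ (n + 1))⁻¹ * f * a ^ (n + 1) = a⁻¹ * ((a ^ n)⁻¹ * f * a ^ n) * a⁻¹⁻¹ := by
          rw [pow_succ]; group
      _ = (a⁻¹ * f * a⁻¹⁻¹) ^ ((σ ^ n : (ZMod M)ˣ) : ZMod M).val := by rw [ih, conj_pow]
      _ = _ := by
        rw [inv_inv, h, ← pow_mul]
        apply hcong
        simp [pow_succ, mul_comm]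

/-- A group that is the semidirect product of a cyclic normal subgroup `⟨f⟩` of order `p ^ (e + 1)`
by a core-free cyclic subgroup `⟨a⟩` of order `p ^ e * (p - 1)` is `G₁(p, e)`. -/
theorem exists_mulEquiv_of_semidirect (h5 : 5 ≤ p) {r : (ZMod (p ^ (e + 1)))ˣ}
    (hr : ∀ u, u ∈ Subgroup.zpowers r) {G : Type*} [Group G] {a b f : G}
    (ha : orderOf a = p ^ e * (p - 1)) (hf : orderOf f = p ^ (e + 1))
    (hdisj : ∀ i j : ℤ, a ^ i = f ^ j → a ^ i = 1) (hconj : a⁻¹ * f * a ∈ Subgroup.zpowers f)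
    (hb : b = a ^ (p ^ e * (p - 1) / 2) * f)
    (hcore : ∀ i : ℤ, Commute (a ^ i) b → a ^ i = 1) (hgen : Subgroup.closure {a, b} = ⊤) :
    ∃ (φ : G1 p e r ≃* G) (j : (ZMod (p ^ e * (p - 1)))ˣ),
      φ (G1.a p e r ^ (j : ZMod (p ^ e * (p - 1))).val) = a ∧ φ (G1.b p e r) = b := by
  have hN : NeZero (p ^ e * (p - 1)) := ⟨(card_pos p e).ne'⟩
  have hM : NeZero (p ^ (e + 1)) := ⟨(pow_pos hp.out.pos _).ne'⟩
  have haN : a ^ (p ^ e * (p - 1)) = 1 := by rw [← ha, pow_orderOf_eq_one]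
  have hfM : f ^ (p ^ (e + 1)) = 1 := by rw [← hf, pow_orderOf_eq_one]
  have hfcong : ∀ {m n : ℕ}, (m : ZMod (p ^ (e + 1))) = n ↔ f ^ m = f ^ n := by
    intro m n
    rw [pow_eq_pow_iff_modEq, hf, ZMod.natCast_eq_natCast_iff]
  -- the action of `a` on `⟨f⟩`
  obtain ⟨s, hs⟩ : ∃ s : ℕ, a⁻¹ * f * a = f ^ s := by
    have hfo : IsOfFinOrder f := isOfFinOrder_iff_pow_eq_one.2 ⟨_, pow_pos hp.out.pos _, hfM⟩
    obtain ⟨s, hs⟩ := hfo.mem_powers_iff_mem_zpowers.2 hconj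
    exact ⟨s, hs.symm⟩
  have hsn : ∀ n : ℕ, (a ^ n)⁻¹ * f * a ^ n = f ^ (s ^ n) := by
    intro n
    induction n with
    | zero => simp
    | succ n ih =>
      calc (a ^ (n + 1))⁻¹ * f * a ^ (n + 1) = a⁻¹ * ((a ^ n)⁻¹ * f * a ^ n) * a⁻¹⁻¹ := by
            rw [pow_succ]; group
        _ = (a⁻¹ * f * a⁻¹⁻¹) ^ (s ^ n) := by rw [ih, conj_pow]
        _ = _ := by rw [inv_inv, hs, ← pow_mul, pow_succ']
  have hsN : (s : ZMod (p ^ (e + 1))) ^ (p ^ e * (p - 1)) = 1 := by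
    have h := hsn (p ^ e * (p - 1))
    rw [haN, inv_one, one_mul, mul_one] at h
    have h' : f ^ 1 = f ^ (s ^ (p ^ e * (p - 1))) := by rw [pow_one, ← h]
    rw [← hfcong] at h'
    push_cast at h'
    exact h'.symm
  obtain ⟨σ, hσ⟩ : IsUnit (s : ZMod (p ^ (e + 1))) :=
    IsUnit.of_pow_eq_one hsN (card_pos p e).ne'
  have hσconj : a⁻¹ * f * a = f ^ (σ : ZMod (p ^ (e + 1))).val := by
    rw [hs, ← hfcong, hσ]; simp
  have hσn := conj_pow_unit hfM hσconj
  -- A power of `a` that centralizes `f` also commutes with `b`, hence is trivial. So `a` acts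
  -- faithfully and `σ` generates the whole unit group.
  have hσord : p ^ e * (p - 1) ∣ orderOf σ := by
    rw [← ha, orderOf_dvd_iff_pow_eq_one, ← zpow_natCast]
    apply hcore
    have h := hσn (orderOf σ)
    rw [pow_orderOf_eq_one] at h
    have h1 : Commute (a ^ orderOf σ) f := by
      have h2 : f ^ ((1 : (ZMod (p ^ (e + 1)))ˣ) : ZMod (p ^ (e + 1))).val = f ^ 1 := by
        rw [← hfcong]; simp
      rw [h2, pow_one, mul_assoc, inv_mul_eq_iff_eq_mul] at h
      exact h.symm
    rw [zpow_natCast, hb]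
    exact (((Commute.refl a).pow_left _).pow_right _).mul_right h1
  have hro : orderOf r = p ^ e * (p - 1) := by
    rw [orderOf_eq_card_of_forall_mem_zpowers hr, Nat.card_eq_fintype_card, card_units]
  have hσgen : ∀ u, u ∈ Subgroup.zpowers σ := by
    intro u
    have h1 : orderOf σ = Nat.card (ZMod (p ^ (e + 1)))ˣ := by
      apply Nat.dvd_antisymm (orderOf_dvd_natCard σ)
      rwa [Nat.card_eq_fintype_card, card_units]
    have h2 : Subgroup.zpowers σ = ⊤ := by
      apply Subgroup.eq_top_of_card_eq
      rw [Nat.card_zpowers, h1]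
    rw [h2]
    trivial
  have hσo : orderOf σ = p ^ e * (p - 1) := by
    rw [orderOf_eq_card_of_forall_mem_zpowers hσgen, Nat.card_eq_fintype_card, card_units]
  -- The presentation wants `r` as the action of its first generator, so that generator goes to `a ^
  -- t` with `r = σ ^ t`; then `j` is the inverse of `t`.
  obtain ⟨t, ht⟩ := (mem_powers_iff_mem_zpowers (x := σ) (y := r)).2 (hσgen r)
  simp only at ht
  have htco : Nat.Coprime t (p ^ e * (p - 1)) := by
    have h1 := orderOf_pow σ (n := t)
    rw [ht, hro, hσo] at h1
    have h2 : Nat.gcd (p ^ e * (p - 1)) t ∣ p ^ e * (p - 1) := Nat.gcd_dvd_left _ _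
    have h3 := Nat.div_mul_cancel h2
    rw [← h1] at h3
    rw [Nat.coprime_comm]
    exact Nat.eq_of_mul_eq_mul_left (card_pos p e) (h3.trans (mul_one _).symm)
  set j : (ZMod (p ^ e * (p - 1)))ˣ := (ZMod.unitOfCoprime t htco)⁻¹ with hj
  have haj : (a ^ t) ^ (j : ZMod (p ^ e * (p - 1))).val = a := by
    rw [← pow_mul]
    conv_rhs => rw [← pow_one a]
    refine pow_eq_pow_of_modEq ((ZMod.natCast_eq_natCast_iff _ _ _).1 ?_) haN
    push_cast
    rw [ZMod.natCast_zmod_val, ← ZMod.coe_unitOfCoprime t htco, hj, Units.mul_inv]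
  have hhalf : (a ^ t) ^ (p ^ e * (p - 1) / 2) = a ^ (p ^ e * (p - 1) / 2) :=
    pow_half_of_coprime haN (two_dvd h5) htco
  let φ : G1 p e r →* G := PresentedGroup.toGroup (rels := G1Rels p e r) (f := ![a ^ t, f]) (by
    rintro _ (rfl | rfl | rfl)
    · simp only [map_pow, FreeGroup.lift_apply_of, Matrix.cons_val_zero]
      rw [← pow_mul, mul_comm, pow_mul, haN, one_pow]
    · simpa only [map_pow, FreeGroup.lift_apply_of, Matrix.cons_val_one,
        Matrix.cons_val_fin_one] using hfM
    · simp only [map_mul, map_inv, map_pow, FreeGroup.lift_apply_of, Matrix.cons_val_zero,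
        Matrix.cons_val_one, Matrix.cons_val_fin_one]
      rw [mul_inv_eq_one, hσn, ht])
  have hφa : φ (G1.a p e r) = a ^ t := PresentedGroup.toGroup.of _
  have hφc : φ (G1.c p e r) = f := PresentedGroup.toGroup.of _
  have hφb : φ (G1.b p e r) = b := by rw [G1.b, map_mul, map_pow, hφa, hφc, hhalf, hb]
  have hφaj : φ (G1.a p e r ^ (j : ZMod (p ^ e * (p - 1))).val) = a := by rw [map_pow, hφa, haj]
  have hsurj : Function.Surjective φ := by
    rw [← MonoidHom.range_eq_top, ← top_le_iff, ← hgen, Subgroup.closure_le]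
    rintro x (rfl | rfl)
    · exact ⟨_, hφaj⟩
    · exact ⟨_, hφb⟩
  have hinj : Function.Injective φ := by
    rw [injective_iff_map_eq_one]
    intro g hg
    obtain ⟨x, hx, y, hy, rfl⟩ := exists_eq_mul g
    obtain ⟨m, rfl⟩ := hx
    obtain ⟨n, rfl⟩ := hy
    simp only at hg ⊢
    rw [map_mul, map_zpow, map_zpow, hφa, hφc] at hg
    have h1 : a ^ ((t : ℤ) * m) = 1 := by
      apply hdisj _ (-n)
      rw [zpow_mul, zpow_natCast, zpow_neg, ← mul_eq_one_iff_eq_inv, hg]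
    rw [← zpow_natCast, ← zpow_mul, h1, one_mul] at hg
    rw [← orderOf_dvd_iff_zpow_eq_one, ha] at h1
    rw [← orderOf_dvd_iff_zpow_eq_one, hf] at hg
    have h2 : ((p ^ e * (p - 1) : ℕ) : ℤ) ∣ m :=
      (Nat.isCoprime_iff_coprime.2 htco.symm).dvd_of_dvd_mul_left h1
    obtain ⟨m, rfl⟩ := h2
    obtain ⟨n, rfl⟩ := hg
    rw [zpow_mul, zpow_mul, zpow_natCast, zpow_natCast, a_pow, c_pow, one_zpow, one_zpow, one_mul]
  exact ⟨MulEquiv.ofBijective φ ⟨hinj, hsurj⟩, j, hφaj, hφb⟩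

end G1

/-! ### From the stabilizer configuration to `G₁(p, e)` -/

section

variable {p e : ℕ} [hp : Fact p.Prime] {G : Type*} [Group G] [Finite G]

/-- Let `a` have order `p ^ e * (p - 1)`, let `H ∋ a` have index `p`, and let `⟨a⟩` meet its
conjugates by elements outside `H` trivially.  If the normal Sylow `p`-subgroup has an element of
order `p ^ (e + 1)`, then it has a cyclic subgroup of that order which is normalized by `a` and
meets `⟨a⟩` trivially. -/
theorem exists_cyclic_complement (h2 : p ≠ 2) {a : G} (ha : orderOf a = p ^ e * (p - 1))
    (hcard : Nat.card G = p ^ (2 * e + 1) * (p - 1)) {H : Subgroup G} (haH : a ∈ H)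
    (hH : H.index = p) (hmal : ∀ g ∉ H, ∀ i j : ℤ, a ^ i = g * a ^ j * g⁻¹ → a ^ i = 1)
    (P : Subgroup G) [hPn : P.Normal] (hPc : Nat.card P = p ^ (2 * e + 1))
    (hPe : ∀ g : P, g ^ p ^ (e + 1) = 1) {c : P} (hc : c ^ p ^ e ≠ 1) :
    ∃ f : G, orderOf f = p ^ (e + 1) ∧ (∀ i j : ℤ, a ^ i = f ^ j → a ^ i = 1) ∧
      a * f * a⁻¹ ∈ Subgroup.zpowers f := by
  have hp2 : 2 < p := lt_of_le_of_ne hp.out.two_le (Ne.symm h2)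
  have hpp : 0 < p ^ (2 * e + 1) := pow_pos hp.out.pos _
  have hPi : P.index = p - 1 := by
    have := P.card_mul_index
    rw [hPc, hcard] at this
    exact Nat.eq_of_mul_eq_mul_left hpp this
  have hcop : Nat.Coprime p (p - 1) := by
    rw [Nat.coprime_comm]
    exact Nat.Coprime.symm ((Nat.Prime.coprime_iff_not_dvd hp.out).2 fun h =>
      absurd (Nat.le_of_dvd (by omega) h) (by omega))
  have hmulindex : H.relIndex P * (p - 1) = (H ⊓ P).index := by
    rw [← hPi, ← Subgroup.inf_relIndex_right, Subgroup.relIndex_mul_index inf_le_right]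
  -- The index of `H ⊓ P` is `relIndex * (p - 1)`. It is a multiple of `H.index = p`, prime to `p -
  -- 1`, and at most `p * (p - 1)`.
  have hrel : H.relIndex P = p := by
    have h3 : p ∣ H.relIndex P := by
      have h4 : H.index ∣ (H ⊓ P).index := Subgroup.index_dvd_of_le inf_le_left
      rw [← hmulindex, hH] at h4
      exact hcop.dvd_of_dvd_mul_right h4
    have h5 : H.relIndex P ≤ p := by
      have h6 := Subgroup.index_inf_le (H := H) (K := P)
      rw [← hmulindex, hH, hPi] at h6
      exact Nat.le_of_mul_le_mul_right h6 (by omega)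
    have h7 : H.relIndex P ≠ 0 := by
      intro h0
      rw [h0, zero_mul] at hmulindex
      exact Subgroup.index_ne_zero_of_finite hmulindex.symm
    exact le_antisymm h5 (Nat.le_of_dvd (Nat.pos_of_ne_zero h7) h3)
  -- the part of `P` inside `H`
  set K : Subgroup P := H.subgroupOf P with hK
  have hKi : K.index = p := hrel
  -- A subgroup whose index is the least prime divisor of the order is normal.
  have hKn : K.Normal := by
    apply Subgroup.normal_of_index_eq_minFac_card
    rw [hKi, hPc, Nat.pow_minFac (by omega), hp.out.minFac_eq]
  have hKmem : ∀ g : P, g ∈ K ↔ (g : G) ∈ H := fun g => Subgroup.mem_subgroupOf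
  have hKc : Nat.card K = p ^ (e + e) := by
    have := K.card_mul_index
    rw [hKi, hPc, show 2 * e + 1 = (e + e) + 1 by ring, pow_succ] at this
    exact Nat.eq_of_mul_eq_mul_right hp.out.pos this
  -- the `p`-part of `a`
  have hzP : a ^ (p - 1) ∈ P := by
    rw [← hPi]
    exact Subgroup.pow_index_mem P a
  have hzo : orderOf (a ^ (p - 1)) = p ^ e := by
    rw [orderOf_pow_of_dvd (by omega) (by rw [ha]; exact dvd_mul_left _ _), ha,
      Nat.mul_div_cancel _ (by omega)]
  set z : P := ⟨a ^ (p - 1), hzP⟩ with hz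
  have hzo' : orderOf z = p ^ e := by rw [← Subgroup.orderOf_coe]; exact hzo
  have hzK : z ∈ K := (hKmem z).2 (H.pow_mem haH _)
  have hmalz : ∀ g ∉ K, ∀ i j : ℤ, z ^ i = g * z ^ j * g⁻¹ → z ^ i = 1 := by
    intro g hg i j hij
    have h3 := congrArg (Subtype.val) hij
    have h4 : a ^ (((p - 1 : ℕ) : ℤ) * i) = g * a ^ (((p - 1 : ℕ) : ℤ) * j) * (g : G)⁻¹ := by
      rw [zpow_mul, zpow_mul, zpow_natCast]
      exact h3
    have h5 := hmal g (fun h => hg ((hKmem g).2 h)) _ _ h4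
    rw [zpow_mul, zpow_natCast] at h5
    exact Subtype.ext h5
  -- `K` has exponent `p ^ e`
  have hKe : ∀ x : K, x ^ p ^ e = 1 := by
    obtain ⟨g, hg⟩ : ∃ g : P, g ∉ K := by
      by_contra! hall
      rw [(Subgroup.eq_top_iff' K).2 hall, Subgroup.index_top] at hKi
      exact hp.out.one_lt.ne hKi
    -- For `g ∉ K` the subgroups `⟨z⟩` and `⟨z⟩^g` of `K` meet trivially, and their orders multiply
    -- to `|K|`.
    have hcf : CyclicFactorization p (⟨z, hzK⟩ : K)
        (⟨g * z * g⁻¹, hKn.conj_mem z hzK g⟩ : K) e e := by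
      apply CyclicFactorization.of_card
      · rw [← Subgroup.orderOf_coe]; exact hzo'
      · rw [← Subgroup.orderOf_coe]
        exact ((orderOf_injective (MulAut.conj g).toMonoidHom (MulAut.conj g).injective z)).trans
          hzo'
      · exact hKc
      · intro i j hij
        have h3 := congrArg (Subtype.val) hij
        apply Subtype.ext
        rw [Subgroup.coe_zpow, Subgroup.coe_zpow] at h3
        rw [Subgroup.coe_zpow]
        refine hmalz g hg i j ?_
        rw [h3, conj_zpow]
    exact CyclicFactorization.pow_eq_one h2 e hcf
  have hcK : c ∉ K := by
    intro h3
    apply hc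
    exact congrArg Subtype.val (hKe ⟨c, h3⟩)
  -- An element of `⟨c⟩ ∩ ⟨z⟩` is fixed under conjugation by `c ∉ K`, so `hmalz` makes it trivial.
  have hcf : CyclicFactorization p c z (e + 1) e := by
    apply CyclicFactorization.of_card
    · exact orderOf_eq_prime_pow hc (hPe c)
    · exact hzo'
    · rw [hPc]; ring
    · intro i j hij
      rw [hij]
      apply hmalz c hcK j j
      rw [← hij, ((Commute.refl c).zpow_right i).mul_inv_cancel]
  have hcore : ∀ i : ℤ, (∀ g, Commute (z ^ i) g) → z ^ i = 1 := by
    intro i hi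
    apply hmalz c hcK i i
    rw [(hi c).symm.mul_inv_cancel]
  -- the `p'`-part of `a` acts on `P`
  set η : P →* P := (MulAut.conjNormal (H := P) (a ^ p ^ e)).toMonoidHom with hη
  have hηval : ∀ g : P, ((η g : P) : G) = a ^ p ^ e * g * (a ^ p ^ e)⁻¹ := fun g =>
    MulAut.conjNormal_apply _ _
  have hηs : Function.Surjective η := (MulAut.conjNormal (H := P) (a ^ p ^ e)).surjective
  have hηz : η z = z := by
    apply Subtype.ext
    rw [hηval]
    exact ((Commute.refl a).pow_pow _ _).mul_inv_cancel
  obtain ⟨u, v, huv⟩ : IsCoprime ((p - 1 : ℕ) : ℤ) ((p ^ e : ℕ) : ℤ) :=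
    Nat.isCoprime_iff_coprime.2 (hcop.symm.pow_right e)
  have hazh : a = (a ^ (p - 1)) ^ u * (a ^ p ^ e) ^ v := by
    rw [← zpow_natCast, ← zpow_natCast, ← zpow_mul, ← zpow_mul, ← zpow_add]
    conv_lhs => rw [← zpow_one a]
    congr 1
    linear_combination -huv
  have hQc : Nat.card (P ⧸ K) = p := hKi
  have hcyc : IsCyclic (P ⧸ K) := isCyclic_of_prime_card hQc
  let _ : CommGroup (P ⧸ K) := IsCyclic.commGroup
  set χ : P →* P ⧸ K := QuotientGroup.mk' K with hχ
  have hχ1 : ∀ g, χ g = 1 ↔ g ∈ K := fun g => QuotientGroup.eq_one_iff g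
  have hQp : ∀ x : P ⧸ K, x ^ p = 1 := by
    intro x
    conv_lhs => rw [← hQc]
    exact pow_card_eq_one'
  have hχc : χ c ≠ 1 := fun h => hcK ((hχ1 c).1 h)
  have hχz : χ z = 1 := (hχ1 z).2 hzK
  obtain ⟨k, hk⟩ : ∃ k : ℤ, (χ c) ^ k = χ (η c) := by
    have h3 : Subgroup.zpowers (χ c) = ⊤ := by
      apply Subgroup.eq_top_of_card_eq
      rw [Nat.card_zpowers, hQc, orderOf_eq_prime (hQp _) hχc]
    have h4 : χ (η c) ∈ Subgroup.zpowers (χ c) := by rw [h3]; trivial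
    exact h4
  have hχη : ∀ g, χ (η g) = χ g ^ k := by
    intro g
    obtain ⟨i, j, rfl⟩ := hcf.exists_eq g
    simp only [map_mul, map_zpow, hηz, hχz, one_zpow, mul_one]
    rw [← hk, zpow_comm]
  -- If `a ^ p ^ e` acted trivially on `P / K`, then `⟨a⟩` and its conjugate by `c⁻¹` would both lie
  -- in `H`. They meet trivially, so `H` would have at least `(p ^ e * (p - 1)) ^ 2` elements, more
  -- than its order `p ^ (2 * e) * (p - 1)`.
  have hk1 : ¬ (p : ℤ) ∣ k - 1 := by
    intro hdvd
    rw [← zpow_ne_one_iff_of_prime (hQp _) hχc, zpow_sub, zpow_one, hk, ← map_inv, ← map_mul,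
      hχ1] at hdvd
    -- then `c⁻¹ a c ∈ H`
    have h3 : (c : G)⁻¹ * a * c ∈ H := by
      have h4 : (c : G)⁻¹ * a ^ (p - 1) * c ∈ H := by
        have := hKn.conj_mem z hzK c⁻¹
        rw [inv_inv, hKmem] at this
        exact this
      have h5 : (c : G)⁻¹ * a ^ p ^ e * c ∈ H := by
        have h6 := hKn.conj_mem _ hdvd c⁻¹
        rw [hKmem] at h6
        simp only [Subgroup.coe_mul, Subgroup.coe_inv, hηval, inv_inv] at h6
        have h7 := H.mul_mem h6 (H.pow_mem haH (p ^ e))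
        have h8 : (c : G)⁻¹ * (a ^ p ^ e * c * (a ^ p ^ e)⁻¹ * (c : G)⁻¹) * c * a ^ p ^ e =
            (c : G)⁻¹ * a ^ p ^ e * c := by group
        rwa [h8] at h7
      have h9 : (c : G)⁻¹ * a * c =
          ((c : G)⁻¹ * a ^ (p - 1) * c) ^ u * ((c : G)⁻¹ * a ^ p ^ e * c) ^ v := by
        have e1 := conj_zpow (i := u) (a := (c : G)⁻¹) (b := a ^ (p - 1))
        have e2 := conj_zpow (i := v) (a := (c : G)⁻¹) (b := a ^ p ^ e)
        rw [inv_inv] at e1 e2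
        rw [e1, e2]
        conv_lhs => rw [hazh]
        group
      rw [h9]
      exact H.mul_mem (H.zpow_mem h4 _) (H.zpow_mem h5 _)
    have hcH : (c : G) ∉ H := fun h => hcK ((hKmem c).2 h)
    have h4 : ∀ x ∈ Subgroup.zpowers a, (c : G)⁻¹ * x * c ∈ H := by
      rintro _ ⟨i, rfl⟩
      have e1 := conj_zpow (i := i) (a := (c : G)⁻¹) (b := a)
      rw [inv_inv] at e1
      simp only
      rw [← e1]
      exact H.zpow_mem h3 i
    let F : Subgroup.zpowers a × Subgroup.zpowers a → H := fun q =>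
      ⟨(c : G)⁻¹ * q.1 * c * q.2, H.mul_mem (h4 _ q.1.2) ((Subgroup.zpowers_le.2 haH) q.2.2)⟩
    have hF : Function.Injective F := by
      rintro ⟨⟨_, i, rfl⟩, ⟨_, j, rfl⟩⟩ ⟨⟨_, k, rfl⟩, ⟨_, l, rfl⟩⟩ hq
      have hq' : (c : G)⁻¹ * a ^ i * c * a ^ j = (c : G)⁻¹ * a ^ k * c * a ^ l :=
        congrArg Subtype.val hq
      have h5 : a ^ (i - k) = c * a ^ (l - j) * (c : G)⁻¹ := by
        rw [sub_eq_neg_add, zpow_add, zpow_sub, zpow_neg, inv_mul_eq_iff_eq_mul]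
        rw [← eq_mul_inv_iff_mul_eq] at hq'
        calc a ^ i = c * ((c : G)⁻¹ * a ^ i * c) * (c : G)⁻¹ := by group
          _ = _ := by rw [hq']; group
      have h6 := hmal c hcH _ _ h5
      rw [h6, eq_comm, conj_eq_one_iff] at h5
      rw [zpow_sub, mul_inv_eq_one] at h5 h6
      exact Prod.ext (Subtype.ext h6) (Subtype.ext h5.symm)
    have h7 := Nat.card_le_card_of_injective F hF
    rw [Nat.card_prod, Nat.card_zpowers, ha] at h7
    have h8 := H.card_mul_index
    rw [hH, hcard] at h8
    have h9 : Nat.card H = p ^ e * (p - 1) * p ^ e := by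
      apply Nat.eq_of_mul_eq_mul_right hp.out.pos
      rw [h8]; ring
    rw [h9] at h7
    have h10 := Nat.le_of_mul_le_mul_left h7 (G1.card_pos p e)
    have h11 : p ^ e * 1 < p ^ e * (p - 1) :=
      Nat.mul_lt_mul_of_pos_left (by omega) (pow_pos hp.out.pos e)
    omega
  obtain ⟨d, hd, hdn, hdη⟩ := CyclicFactorization.exists_normal_factor h2 hQp hk1 e (e + 1) hcf
    hcore η hηs hηz χ hχz hχc hχη
  have hmap : ∀ y : P, y ∈ Subgroup.zpowers d → (y : G) ∈ Subgroup.zpowers (d : G) := by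
    rintro _ ⟨i, rfl⟩
    exact ⟨i, rfl⟩
  refine ⟨d, ?_, ?_, ?_⟩
  · rw [Subgroup.orderOf_coe, hd.orderOf_left]
  · intro i j hij
    have h3 : (a ^ i) ^ p ^ (e + 1) = 1 := by
      have := hPe (d ^ j)
      rw [hij]
      exact congrArg Subtype.val this
    have h4 : ((p - 1 : ℕ) : ℤ) ∣ i := by
      rw [← zpow_natCast, ← zpow_mul, ← orderOf_dvd_iff_zpow_eq_one, ha] at h3
      have h5 : ((p - 1 : ℕ) : ℤ) ∣ i * ((p ^ (e + 1) : ℕ) : ℤ) :=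
        (Int.natCast_dvd_natCast.2 (dvd_mul_left _ _)).trans h3
      exact (Nat.isCoprime_iff_coprime.2 (hcop.symm.pow_right (e + 1))).dvd_of_dvd_mul_right h5
    obtain ⟨i, rfl⟩ := h4
    have h5 : d ^ j * z ^ (-i) = 1 := by
      apply Subtype.ext
      rw [Subgroup.coe_mul, Subgroup.coe_zpow, ← hij, Subgroup.coe_zpow, zpow_mul, zpow_natCast,
        hz, zpow_neg]
      exact mul_inv_cancel _
    have h6 := (hd.eq_one_iff _ _).1 h5
    rw [hij]
    exact congrArg Subtype.val ((hd.zpow_left_eq_one_iff j).2 h6.1)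
  · have hzn : a ^ (p - 1) ∈ Subgroup.normalizer (Subgroup.zpowers (d : G) : Set G) :=
      mem_normalizer_zpowers_of_conj_mem (hmap _ (hdn z))
    have hhn : a ^ p ^ e ∈ Subgroup.normalizer (Subgroup.zpowers (d : G) : Set G) := by
      apply mem_normalizer_zpowers_of_conj_mem
      rw [← hηval]
      exact hmap _ hdη
    have han : a ∈ Subgroup.normalizer (Subgroup.zpowers (d : G) : Set G) := by
      rw [hazh]
      exact mul_mem (zpow_mem hzn _) (zpow_mem hhn _)
    exact (Subgroup.mem_normalizer_iff.1 han d).1 (Subgroup.mem_zpowers _)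

/-- The Sylow subgroup is normal since the number of Sylow `p`-subgroups divides `p - 1` and is `1`
modulo `p`. The cyclic complement `⟨f⟩` of `⟨a⟩` then makes `G` a semidirect product; it remains to
change the generator `f` so that `b` takes the prescribed form. -/
theorem exists_mulEquiv_G1 (h5 : 5 ≤ p) {r : (ZMod (p ^ (e + 1)))ˣ}
    (hr : ∀ u, u ∈ Subgroup.zpowers r) {a b : G} (ha : orderOf a = p ^ e * (p - 1))
    (hcard : Nat.card G = p ^ (2 * e + 1) * (p - 1)) {H : Subgroup G} (haH : a ∈ H)
    (hH : H.index = p) (hmal : ∀ g ∉ H, ∀ i j : ℤ, a ^ i = g * a ^ j * g⁻¹ → a ^ i = 1)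
    (hb : b * b = 1) (hbH : b ∉ H) (hgen : Subgroup.closure {a, b} = ⊤) (P : Sylow p G)
    (hP : Monoid.exponent P = p ^ (e + 1)) :
    ∃ (φ : G1 p e r ≃* G) (j : (ZMod (p ^ e * (p - 1)))ˣ),
      φ (G1.a p e r ^ (j : ZMod (p ^ e * (p - 1))).val) = a ∧ φ (G1.b p e r) = b := by
  have h2 : p ≠ 2 := by omega
  have hndvd : ¬ p ∣ p - 1 := fun h => absurd (Nat.le_of_dvd (by omega) h) (by omega)
  have hPc : Nat.card P = p ^ (2 * e + 1) := by
    rw [P.card_eq_multiplicity, hcard, Nat.factorization_mul (by positivity) (by omega)]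
    simp [Nat.factorization_eq_zero_of_not_dvd hndvd, hp.out.factorization_self]
  have hPn : (P : Subgroup G).Normal := by
    have h3 := P.card_dvd_index
    have h4 : (P : Subgroup G).index = p - 1 := by
      have := (P : Subgroup G).card_mul_index
      rw [hcard] at this
      rw [show Nat.card (P : Subgroup G) = p ^ (2 * e + 1) from hPc] at this
      exact Nat.eq_of_mul_eq_mul_left (pow_pos hp.out.pos _) this
    rw [h4] at h3
    have h5 : Nat.card (Sylow p G) = 1 := by
      have h6 := card_sylow_modEq_one p G
      have h7 := Nat.le_of_dvd (by omega) h3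
      have h8 : Nat.card (Sylow p G) < p := by omega
      unfold Nat.ModEq at h6
      rwa [Nat.mod_eq_of_lt h8, Nat.mod_eq_of_lt hp.out.one_lt] at h6
    have : Subsingleton (Sylow p G) := (Nat.card_eq_one_iff_unique.1 h5).1
    exact P.normal_of_subsingleton
  have hPe : ∀ g : P, g ^ p ^ (e + 1) = 1 := fun g => by
    rw [← hP]; exact Monoid.pow_exponent_eq_one g
  obtain ⟨c, hc⟩ : ∃ c : P, c ^ p ^ e ≠ 1 := by
    by_contra! hall
    have h3 : Monoid.exponent (P : Subgroup G) ∣ p ^ e :=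
      Monoid.exponent_dvd_of_forall_pow_eq_one hall
    rw [hP] at h3
    have := (Nat.pow_dvd_pow_iff_le_right hp.out.one_lt).1 h3
    omega
  obtain ⟨f, hf, hdisj, hconj⟩ := exists_cyclic_complement h2 ha hcard haH hH hmal P hPc hPe hc
  -- `G` is the semidirect product of `⟨f⟩` by `⟨a⟩`
  have hcomp : Subgroup.IsComplement' (Subgroup.zpowers a) (Subgroup.zpowers f) := by
    apply Subgroup.isComplement'_of_card_mul_and_disjoint
    · rw [Nat.card_zpowers, Nat.card_zpowers, ha, hf, hcard]; ring
    · rw [Subgroup.disjoint_def]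
      rintro _ ⟨i, rfl⟩ ⟨j, hj⟩
      exact hdisj i j hj.symm
  have haf : a⁻¹ * f * a ∈ Subgroup.zpowers f := by
    have := zpow_conj_mem_zpowers hconj (-1)
    simpa using this
  have han : a ∈ Subgroup.normalizer (Subgroup.zpowers f : Set G) :=
    mem_normalizer_zpowers_of_conj_mem hconj
  obtain ⟨⟨⟨_, i, rfl⟩, ⟨_, k, rfl⟩⟩, hbik⟩ := hcomp.2 b
  replace hbik : a ^ i * f ^ k = b := hbik
  have hi2 : a ^ (i + i) = 1 := by
    have h3 : (a ^ i)⁻¹ * f ^ k * (a ^ i) * f ^ k ∈ Subgroup.zpowers f := by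
      refine mul_mem ?_ (Subgroup.zpow_mem_zpowers _ _)
      have := (Subgroup.mem_normalizer_iff.1 (inv_mem (zpow_mem han i)) (f ^ k)).1
        (Subgroup.zpow_mem_zpowers _ _)
      rwa [inv_inv] at this
    obtain ⟨l, hl⟩ := h3
    apply hdisj _ (-l)
    rw [zpow_neg, ← mul_eq_one_iff_eq_inv]
    simp only at hl
    rw [hl, ← hb, ← hbik]
    group
  obtain ⟨n, hn⟩ := G1.two_dvd (p := p) (e := e) h5
  have hn2 : p ^ e * (p - 1) / 2 = n := by omega
  have han2 : a ^ n * a ^ n = 1 := by rw [← pow_add, ← two_mul, ← hn, ← ha, pow_orderOf_eq_one]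
  rw [← orderOf_dvd_iff_zpow_eq_one, ha, hn] at hi2
  obtain ⟨t, ht⟩ := hi2
  have hit : i = n * t := by push_cast at ht; linarith
  -- Modulo `⟨f⟩` the involution `b` becomes `a ^ i`, so `a ^ i` is `1` or `a ^ n`. The first would
  -- put `b ≠ 1` into `⟨f⟩`, of odd order.
  have hain : a ^ i = a ^ n := by
    rcases Int.even_or_odd' t with ⟨w, rfl | rfl⟩
    · exfalso
      have h3 : a ^ i = 1 := by
        rw [hit, zpow_mul, zpow_natCast, zpow_mul, zpow_two, han2, one_zpow]
      rw [h3, one_mul] at hbik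
      have h4 : orderOf b ∣ p ^ (e + 1) := by
        rw [← hbik, ← hf]
        exact orderOf_dvd_of_mem_zpowers (Subgroup.zpow_mem_zpowers f k)
      have h6 : orderOf b ∣ 2 := orderOf_dvd_of_pow_eq_one (by rw [pow_two, hb])
      have h7 : Nat.Coprime (p ^ (e + 1)) 2 :=
        Nat.Coprime.pow_left _ ((Nat.coprime_primes hp.out Nat.prime_two).2 h2)
      have h8 := Nat.eq_one_of_dvd_coprimes h7 h4 h6
      rw [orderOf_eq_one_iff] at h8
      exact hbH (h8 ▸ H.one_mem)
    · rw [hit, zpow_mul, zpow_natCast, zpow_add, zpow_mul, zpow_two, han2, one_zpow, one_mul,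
        zpow_one]
  rw [hain] at hbik
  set f' := f ^ k with hf'
  have hf'mem : f' ∈ Subgroup.zpowers f := Subgroup.zpow_mem_zpowers _ _
  have haf' : a⁻¹ * f' * a ∈ Subgroup.zpowers f' := by
    obtain ⟨s, hs⟩ := haf
    refine ⟨s, ?_⟩
    have e1 := conj_zpow (i := k) (a := a⁻¹) (b := f)
    rw [inv_inv] at e1
    simp only at hs ⊢
    rw [hf', ← e1, ← hs, zpow_comm]
  have hN' : (Subgroup.zpowers f').Normal := by
    rw [← Subgroup.normalizer_eq_top_iff, ← top_le_iff, ← hgen, Subgroup.closure_le]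
    have h3 : a ∈ Subgroup.normalizer (Subgroup.zpowers f' : Set G) := by
      rw [← inv_mem_iff]
      apply mem_normalizer_zpowers_of_conj_mem
      rwa [inv_inv]
    have h4 : f' ∈ Subgroup.normalizer (Subgroup.zpowers f' : Set G) :=
      Subgroup.le_normalizer (Subgroup.mem_zpowers _)
    rintro x (rfl | rfl)
    · exact h3
    · rw [← hbik]
      exact mul_mem (pow_mem h3 _) h4
  -- Since `a` and `b` generate, `⟨a⟩⟨f'⟩` is the whole group; writing `f` in it, the component in
  -- `⟨a⟩` lies in `⟨f⟩` and is trivial.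
  have hff' : f ∈ Subgroup.zpowers f' := by
    have h3 : Subgroup.zpowers a ⊔ Subgroup.zpowers f' = ⊤ := by
      rw [← top_le_iff, ← hgen, Subgroup.closure_le]
      have h4 : a ∈ Subgroup.zpowers a ⊔ Subgroup.zpowers f' :=
        Subgroup.mem_sup_left (Subgroup.mem_zpowers a)
      rintro x (rfl | rfl)
      · exact h4
      · rw [← hbik]
        exact mul_mem (pow_mem h4 _) (Subgroup.mem_sup_right (Subgroup.mem_zpowers f'))
    have h4 : f ∈ Subgroup.zpowers a ⊔ Subgroup.zpowers f' := by rw [h3]; trivial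
    obtain ⟨_, ⟨s, rfl⟩, y, hy, hsy⟩ := Subgroup.mem_sup_of_normal_right.1 h4
    simp only at hsy
    obtain ⟨l, hl⟩ : a ^ s ∈ Subgroup.zpowers f := by
      rw [← eq_mul_inv_iff_mul_eq] at hsy
      rw [hsy]
      exact mul_mem (Subgroup.mem_zpowers f) (inv_mem (Subgroup.zpowers_le.2 hf'mem hy))
    rw [hdisj s l hl.symm, one_mul] at hsy
    rwa [← hsy]
  have hf'o : orderOf f' = p ^ (e + 1) := by
    rw [← hf]
    exact Nat.dvd_antisymm (orderOf_dvd_of_mem_zpowers hf'mem) (orderOf_dvd_of_mem_zpowers hff')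
  refine G1.exists_mulEquiv_of_semidirect h5 hr ha hf'o ?_ haf' ?_ ?_ hgen
  · intro i j hij
    apply hdisj i (k * j)
    rw [hij, hf', zpow_mul]
  · rw [hn2, hbik]
  · intro i hi
    apply hmal b hbH i i
    rw [hi.symm.mul_inv_cancel]

end

/-! ### Automorphisms of maps acting on darts and vertices -/

lemma perm_apply_inv_self {α : Type*} (e : Equiv.Perm α) (x : α) : e (e⁻¹ x) = x := by
  rw [← Equiv.Perm.mul_apply, mul_inv_cancel, Equiv.Perm.one_apply]

namespace SimpleGraph.Iso

variable {V W : Type*} {Γ : SimpleGraph V} {Δ : SimpleGraph W}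

lemma mapDart_injective (φ : Γ ≃g Δ) : Function.Injective φ.toHom.mapDart := by
  intro x y hxy
  ext
  · exact φ.injective (congrArg (fun z => z.fst) hxy)
  · exact φ.injective (congrArg (fun z => z.snd) hxy)

lemma mapDart_symm_mapDart (φ : Γ ≃g Δ) (d : Δ.Dart) :
    φ.toHom.mapDart (φ.symm.toHom.mapDart d) = d := by
  ext
  · exact φ.apply_symm_apply d.fst
  · exact φ.apply_symm_apply d.snd

end SimpleGraph.Iso

namespace OrientedMap

variable {V : Type*} {Γ : SimpleGraph V} {W : Type*} {Δ : SimpleGraph W}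

lemma Preserves.symm {M : OrientedMap Γ} {N : OrientedMap Δ} {φ : Γ ≃g Δ} (h : M.Preserves N φ) :
    N.Preserves M φ.symm := by
  intro d
  apply φ.mapDart_injective
  rw [φ.mapDart_symm_mapDart, h, φ.mapDart_symm_mapDart]

lemma Isomorphic.symm {M : OrientedMap Γ} {N : OrientedMap Δ} (h : M.Isomorphic N) :
    N.Isomorphic M :=
  h.elim fun _ hφ => ⟨_, hφ.symm⟩

lemma Preserves.zpow {M : OrientedMap Γ} {N : OrientedMap Δ} {φ : Γ ≃g Δ} (h : M.Preserves N φ)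
    (i : ℤ) (d : Γ.Dart) :
    φ.toHom.mapDart ((M.rot ^ i) d) = (N.rot ^ i) (φ.toHom.mapDart d) := by
  have hn : ∀ (n : ℕ) (d : Γ.Dart),
      φ.toHom.mapDart ((M.rot ^ n) d) = (N.rot ^ n) (φ.toHom.mapDart d) := by
    intro n
    induction n with
    | zero => intro d; rfl
    | succ n ih =>
      intro d
      rw [pow_succ, Equiv.Perm.mul_apply, ih, h, pow_succ, Equiv.Perm.mul_apply]
  obtain ⟨n, rfl | rfl⟩ := i.eq_nat_or_neg
  · simpa using hn n d
  · rw [zpow_neg, zpow_neg, Equiv.Perm.eq_inv_iff_eq, zpow_natCast, zpow_natCast, ← hn,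
      perm_apply_inv_self]

lemma rot_zpow_fst (M : OrientedMap Γ) (i : ℤ) (d : Γ.Dart) : ((M.rot ^ i) d).fst = d.fst := by
  have hn : ∀ (n : ℕ) (d : Γ.Dart), ((M.rot ^ n) d).fst = d.fst := by
    intro n
    induction n with
    | zero => intro d; rfl
    | succ n ih => intro d; rw [pow_succ, Equiv.Perm.mul_apply, ih, M.rot_fst]
  obtain ⟨n, rfl | rfl⟩ := i.eq_nat_or_neg
  · simpa using hn n d
  · have := hn n ((M.rot ^ (-(n : ℤ))) d)
    rw [← this, zpow_neg, zpow_natCast, perm_apply_inv_self]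

/-- Induction along the edges of the underlying graph, starting at the initial vertex of a dart. -/
lemma vertex_induction (M : OrientedMap Γ) {p : V → Prop} {v : V} (hv : p v)
    (h : ∀ x y, Γ.Adj x y → p x → p y) (w : V) : p w := by
  have hr := M.connected.preconnected v w
  rw [SimpleGraph.reachable_iff_reflTransGen] at hr
  induction hr with
  | refl => exact hv
  | tail _ hxy ih => exact h _ _ hxy ih

/-- The automorphism group of a map acts on its darts. -/
instance (M : OrientedMap Γ) : MulAction M.autPlus Γ.Dart where
  smul g d := (g : Γ ≃g Γ).toHom.mapDart d
  one_smul _ := rfl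
  mul_smul _ _ _ := rfl

/-- The automorphism group of a map acts on its vertices. -/
instance (M : OrientedMap Γ) : MulAction M.autPlus V where
  smul g v := (g : Γ ≃g Γ) v
  one_smul _ := rfl
  mul_smul _ _ _ := rfl

variable {M : OrientedMap Γ}

lemma smul_dart_fst (g : M.autPlus) (d : Γ.Dart) : (g • d).fst = g • d.fst := rfl

lemma smul_dart_symm (g : M.autPlus) (d : Γ.Dart) : (g • d).symm = g • d.symm := rfl

lemma smul_rot_zpow (g : M.autPlus) (i : ℤ) (d : Γ.Dart) :
    g • (M.rot ^ i) d = (M.rot ^ i) (g • d) :=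
  Preserves.zpow g.2 i d

lemma smul_rot (g : M.autPlus) (d : Γ.Dart) : g • M.rot d = M.rot (g • d) := g.2 d

lemma smul_adj_iff (g : M.autPlus) (v w : V) : Γ.Adj (g • v) (g • w) ↔ Γ.Adj v w :=
  (g : Γ ≃g Γ).map_adj_iff

/-- An automorphism of a map that fixes a dart is the identity. -/
lemma eq_one_of_smul_dart {g : M.autPlus} {d : Γ.Dart} (h : g • d = d) : g = 1 := by
  have key : ∀ v, g • v = v ∧ ∀ d' : Γ.Dart, d'.fst = v → g • d' = d' := by
    have hstep : ∀ d d' : Γ.Dart, g • d = d → d'.fst = d.fst → g • d' = d' := by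
      intro d d' hd hdd
      obtain ⟨i, rfl⟩ := M.rot_sameCycle d d' hdd.symm
      rw [smul_rot_zpow, hd]
    refine M.vertex_induction (p := fun v => g • v = v ∧ ∀ d' : Γ.Dart, d'.fst = v → g • d' = d')
      (v := d.fst) ?_ ?_
    · exact ⟨by rw [← smul_dart_fst, h], fun d' hd' => hstep d d' h hd'⟩
    · rintro x y hxy ⟨_, hx⟩
      have h1 := hx ⟨(x, y), hxy⟩ rfl
      have h2 : g • (⟨(y, x), hxy.symm⟩ : Γ.Dart) = ⟨(y, x), hxy.symm⟩ := by
        have h3 := smul_dart_symm g ⟨(x, y), hxy⟩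
        rw [h1] at h3
        exact h3.symm
      exact ⟨congrArg (fun z => z.fst) h2, fun d' hd' => hstep _ d' h2 hd'⟩
  apply Subtype.ext
  ext v
  exact (key v).1

lemma smul_dart_injective (d : Γ.Dart) : Function.Injective fun g : M.autPlus => g • d := by
  intro g h hgh
  have h1 : (h⁻¹ * g) • d = d := by
    rw [mul_smul, inv_smul_eq_iff]
    exact hgh
  have := eq_one_of_smul_dart h1
  rw [inv_mul_eq_one] at this
  exact this.symm

lemma isOrientablyRegular_of_transitive (d₀ : Γ.Dart)
    (h : ∀ d : Γ.Dart, ∃ g : M.autPlus, g • d₀ = d) : M.IsOrientablyRegular := by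
  intro d d'
  obtain ⟨g, rfl⟩ := h d
  obtain ⟨g', rfl⟩ := h d'
  refine ⟨g' * g⁻¹, ?_, ?_⟩
  · change (g' * g⁻¹) • g • d₀ = g' • d₀
    rw [mul_smul, inv_smul_smul]
  · intro k hk
    apply smul_dart_injective (g • d₀)
    change k • g • d₀ = (g' * g⁻¹) • g • d₀
    rw [mul_smul, inv_smul_smul]
    exact hk

lemma IsOrientablyRegular.exists_smul_eq (hM : M.IsOrientablyRegular) (d d' : Γ.Dart) :
    ∃ g : M.autPlus, g • d = d' :=
  (hM d d').exists

end OrientedMap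

/-! ### Regularity of algebraic maps and reconstruction from the group -/

namespace AlgebraicTriple

open OrientedMap

variable {H : Type*} [Group H] (T : AlgebraicTriple H)

/-- Right multiplication by a group element is an automorphism of the coset graph. -/
def mulRight (x : H) : T.cosetGraph ≃g T.cosetGraph where
  toFun := Quotient.map' (· * x) (fun g h hgh => by
    rw [QuotientGroup.rightRel_apply] at hgh ⊢
    simpa [mul_assoc] using hgh)
  invFun := Quotient.map' (· * x⁻¹) (fun g h hgh => by
    rw [QuotientGroup.rightRel_apply] at hgh ⊢
    simpa [mul_assoc] using hgh)
  left_inv v := by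
    obtain ⟨g, rfl⟩ := T.coset_surjective v
    exact congrArg T.coset (mul_inv_cancel_right g x)
  right_inv v := by
    obtain ⟨g, rfl⟩ := T.coset_surjective v
    exact congrArg T.coset (inv_mul_cancel_right g x)
  map_rel_iff' := by
    intro u v
    obtain ⟨g, rfl⟩ := T.coset_surjective u
    obtain ⟨h, rfl⟩ := T.coset_surjective v
    change T.cosetGraph.Adj (T.coset (g * x)) (T.coset (h * x)) ↔ _
    constructor
    · rintro ⟨k, h1, h2⟩
      refine ⟨k * x⁻¹, ?_, ?_⟩
      · rw [coset_eq] at h1 ⊢; simpa [mul_assoc] using h1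
      · rw [coset_eq] at h2 ⊢; simpa [mul_assoc] using h2
    · rintro ⟨k, h1, h2⟩
      refine ⟨k * x, ?_, ?_⟩
      · rw [coset_eq] at h1 ⊢; simpa [mul_assoc] using h1
      · rw [coset_eq] at h2 ⊢; simpa [mul_assoc] using h2

lemma mulRight_arc (x g : H) : (T.mulRight x).toHom.mapDart (T.arc g) = T.arc (g * x) := by
  ext
  · rfl
  · exact congrArg T.coset (mul_assoc T.b g x)

lemma mulRight_preserves (x : H) : T.toMap.Preserves T.toMap (T.mulRight x) := by
  intro d
  obtain ⟨g, rfl⟩ := T.arc_surjective d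
  change (T.mulRight x).toHom.mapDart (T.rotation (T.arc g)) = T.rotation _
  rw [rotation_arc, mulRight_arc, mulRight_arc, rotation_arc, mul_assoc]

lemma toMap_isOrientablyRegular : T.toMap.IsOrientablyRegular := by
  apply isOrientablyRegular_of_transitive (T.arc 1)
  intro d
  obtain ⟨g, rfl⟩ := T.arc_surjective d
  refine ⟨⟨T.mulRight g, T.mulRight_preserves g⟩, ?_⟩
  exact (T.mulRight_arc g 1).trans (by rw [one_mul])

/-- An orientably-regular map is recovered from its automorphism group. -/
theorem isomorphic_toMap {V : Type*} {Γ : SimpleGraph V} {M : OrientedMap Γ}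
    (hM : M.IsOrientablyRegular) (φ : H ≃* M.autPlus) (d₀ : Γ.Dart)
    (ha : φ T.a • d₀ = M.rot⁻¹ d₀) (hb : φ T.b • d₀ = d₀.symm) : M.Isomorphic T.toMap := by
  -- Vertices are right cosets while automorphisms act on the left, so group elements label darts
  -- through their inverses. This is why `a` must move `d₀` by the inverse rotation: then left
  -- multiplication by `a` is the rotation.
  set δ : H → Γ.Dart := fun g => (φ g)⁻¹ • d₀ with hδ
  have hδinj : Function.Injective δ := by
    intro g h hgh
    exact φ.injective (inv_injective (smul_dart_injective d₀ hgh))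
  have hδsurj : Function.Surjective δ := by
    intro d
    obtain ⟨g, hg⟩ := hM.exists_smul_eq d₀ d
    refine ⟨φ.symm g⁻¹, ?_⟩
    rw [hδ]
    simpa using hg
  have hδa : ∀ g, δ (T.a * g) = M.rot (δ g) := by
    intro g
    simp only [hδ, map_mul, mul_inv_rev, mul_smul]
    rw [← smul_rot]
    congr 1
    rw [inv_smul_eq_iff, smul_rot, ha, perm_apply_inv_self]
  have hδb : ∀ g, δ (T.b * g) = (δ g).symm := by
    intro g
    simp only [hδ, map_mul, mul_inv_rev, mul_smul]
    rw [smul_dart_symm]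
    congr 1
    rw [inv_smul_eq_iff, ← smul_dart_symm, hb, SimpleGraph.Dart.symm_symm]
  have hδai : ∀ (i : ℤ) g, δ (T.a ^ i * g) = (M.rot ^ i) (δ g) := by
    intro i
    have hn : ∀ (n : ℕ) g, δ (T.a ^ n * g) = (M.rot ^ n) (δ g) := by
      intro n
      induction n with
      | zero => intro g; simp
      | succ n ih => intro g; rw [pow_succ, mul_assoc, ih, hδa, pow_succ, Equiv.Perm.mul_apply]
    obtain ⟨n, rfl | rfl⟩ := i.eq_nat_or_neg
    · simpa using hn n
    · intro g
      rw [zpow_neg, zpow_neg, Equiv.Perm.eq_inv_iff_eq, zpow_natCast, zpow_natCast, ← hn,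
        mul_inv_cancel_left]
  have hfst : ∀ g h, (δ g).fst = (δ h).fst ↔ T.coset g = T.coset h := by
    intro g h
    rw [coset_eq]
    constructor
    · intro hgh
      obtain ⟨i, hi⟩ := M.rot_sameCycle _ _ hgh
      rw [← hδai] at hi
      exact ⟨i, by rw [← hδinj hi]; simp⟩
    · rintro ⟨i, hi⟩
      have : h = T.a ^ i * g := by
        simp only at hi
        rw [hi, inv_mul_cancel_right]
      rw [this, hδai, rot_zpow_fst]
  let f : T.Vertex → V := Quotient.lift (fun g => (δ g).fst) (fun g h hgh =>
    (hfst g h).2 (Quotient.sound hgh))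
  have hf : ∀ g, f (T.coset g) = (δ g).fst := fun g => rfl
  have hbij : Function.Bijective f := by
    constructor
    · intro u v huv
      obtain ⟨g, rfl⟩ := T.coset_surjective u
      obtain ⟨h, rfl⟩ := T.coset_surjective v
      exact (hfst g h).1 huv
    · refine M.vertex_induction (p := fun v => ∃ u, f u = v) (v := d₀.fst) ?_ ?_
      · exact ⟨T.coset 1, by rw [hf]; simp [hδ]⟩
      · intro x y hxy _
        obtain ⟨g, hg⟩ := hδsurj ⟨(y, x), hxy.symm⟩
        exact ⟨T.coset g, by rw [hf, hg]⟩
  have hsnd : ∀ g, f (T.coset (T.b * g)) = (δ g).snd := by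
    intro g
    rw [hf, hδb]
    rfl
  let Φ : T.cosetGraph ≃g Γ :=
    { Equiv.ofBijective f hbij with
      map_rel_iff' := by
        intro u v
        change Γ.Adj (f u) (f v) ↔ _
        constructor
        · intro huv
          obtain ⟨g, hg⟩ := hδsurj ⟨(f u, f v), huv⟩
          refine ⟨g, hbij.1 ?_, hbij.1 ?_⟩
          · rw [hf, hg]
          · rw [hsnd, hg]
        · rintro ⟨g, rfl, rfl⟩
          rw [hf, hsnd]
          exact (δ g).adj }
  have hΦ : ∀ g, Φ.toHom.mapDart (T.arc g) = δ g := by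
    intro g
    ext
    · exact hf g
    · exact hsnd g
  refine Isomorphic.symm ⟨Φ, fun d => ?_⟩
  obtain ⟨g, rfl⟩ := T.arc_surjective d
  change Φ.toHom.mapDart (T.rotation (T.arc g)) = _
  rw [rotation_arc, hΦ, hΦ, hδa]

end AlgebraicTriple

/-! ### Dart counts in complete multipartite graphs -/

section

variable {V W : Type*} {Γ : SimpleGraph V} {Δ : SimpleGraph W}

/-- The bijection between darts induced by a graph isomorphism. -/
def SimpleGraph.Iso.dartEquiv (φ : Γ ≃g Δ) : Γ.Dart ≃ Δ.Dart where
  toFun := φ.toHom.mapDart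
  invFun := φ.symm.toHom.mapDart
  left_inv := φ.symm.mapDart_symm_mapDart
  right_inv := φ.mapDart_symm_mapDart

lemma natCard_dart_of_iso {m n : ℕ} (ψ : Γ ≃g SimpleGraph.completeEquipartiteGraph m n) :
    Nat.card Γ.Dart = m * n * ((m - 1) * n) := by
  classical
  rw [Nat.card_congr ψ.dartEquiv, Nat.card_eq_fintype_card, SimpleGraph.dart_card_eq_sum_degrees]
  simp [SimpleGraph.degree_completeEquipartiteGraph]

lemma natCard_dart_fst_of_iso {m n : ℕ} (ψ : Γ ≃g SimpleGraph.completeEquipartiteGraph m n)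
    (v : V) : Nat.card {d : Γ.Dart // d.fst = v} = (m - 1) * n := by
  classical
  let F : {d : Γ.Dart // d.fst = v} → Γ.neighborSet v := fun d =>
    ⟨d.1.snd, (SimpleGraph.mem_neighborSet _ _ _).2 (by have := d.1.adj; rwa [d.2] at this)⟩
  have hF : Function.Bijective F := by
    constructor
    · rintro ⟨d, rfl⟩ ⟨d', hd'⟩ h
      apply Subtype.ext
      apply SimpleGraph.Dart.ext
      exact Prod.ext hd'.symm (congrArg Subtype.val h)
    · rintro ⟨w, hw⟩
      exact ⟨⟨⟨(v, w), hw⟩, rfl⟩, rfl⟩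
  rw [Nat.card_eq_of_bijective F hF, Nat.card_congr (ψ.mapNeighborSet v),
    Nat.card_eq_fintype_card, SimpleGraph.card_neighborSet_eq_degree,
    SimpleGraph.degree_completeEquipartiteGraph]

end

/-! ### The group-theoretic configuration of an embedding -/

namespace OrientedMap

variable {V : Type*} {Γ : SimpleGraph V} {M : OrientedMap Γ}

lemma zpow_smul_eq {a : M.autPlus} {d : Γ.Dart} (ha : a • d = M.rot⁻¹ d) (i : ℤ) :
    a ^ i • d = (M.rot ^ (-i)) d := by
  have hn : ∀ n : ℕ, a ^ n • d = (M.rot ^ (-(n : ℤ))) d := by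
    intro n
    induction n with
    | zero => simp
    | succ n ih =>
      rw [pow_succ', mul_smul, ih, smul_rot_zpow, ha, ← zpow_neg_one, ← Equiv.Perm.mul_apply,
        ← zpow_add]
      congr 2
      push_cast
      ring
  obtain ⟨n, rfl | rfl⟩ := i.eq_nat_or_neg
  · rw [zpow_natCast, hn]
  · rw [zpow_neg, inv_smul_eq_iff, smul_rot_zpow, zpow_natCast, hn, ← Equiv.Perm.mul_apply,
      ← zpow_add]
    simp

lemma exists_zpow_smul {a : M.autPlus} {d d' : Γ.Dart} (ha : a • d = M.rot⁻¹ d)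
    (h : d'.fst = d.fst) : ∃ i : ℤ, a ^ i • d = d' := by
  obtain ⟨i, hi⟩ := M.rot_sameCycle d d' h.symm
  exact ⟨-i, by rw [zpow_smul_eq ha, neg_neg, hi]⟩

lemma orderOf_eq_natCard {a : M.autPlus} {d : Γ.Dart} (ha : a • d = M.rot⁻¹ d) :
    orderOf a = Nat.card {d' : Γ.Dart // d'.fst = d.fst} := by
  rw [← Nat.card_zpowers]
  refine Nat.card_eq_of_bijective (fun s : Subgroup.zpowers a =>
    (⟨(s : M.autPlus) • d, ?_⟩ : {d' : Γ.Dart // d'.fst = d.fst})) ⟨?_, ?_⟩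
  · obtain ⟨_, i, rfl⟩ := s
    simp only
    rw [zpow_smul_eq ha, rot_zpow_fst]
  · intro s t hst
    exact Subtype.ext (smul_dart_injective d (congrArg Subtype.val hst))
  · rintro ⟨d', hd'⟩
    obtain ⟨i, hi⟩ := exists_zpow_smul ha hd'
    exact ⟨⟨a ^ i, i, rfl⟩, Subtype.ext hi⟩

/-- By connectedness the subgroup already reaches every dart: `a` supplies the rotation about a
vertex and `b` the passage across an edge. As the action on darts is free, it is everything. -/
lemma closure_eq_top_of_smul {a b : M.autPlus} {d : Γ.Dart} (ha : a • d = M.rot⁻¹ d)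
    (hb : b • d = d.symm) : Subgroup.closure {a, b} = ⊤ := by
  set S := Subgroup.closure {a, b} with hS
  have haS : a ∈ S := Subgroup.subset_closure (Or.inl rfl)
  have hbS : b ∈ S := Subgroup.subset_closure (Or.inr rfl)
  have key : ∀ v, ∀ d' : Γ.Dart, d'.fst = v → ∃ s ∈ S, s • d = d' := by
    refine M.vertex_induction (p := fun v => ∀ d' : Γ.Dart, d'.fst = v → ∃ s ∈ S, s • d = d')
      (v := d.fst) ?_ ?_
    · intro d' hd'
      obtain ⟨i, hi⟩ := exists_zpow_smul ha hd'
      exact ⟨a ^ i, S.zpow_mem haS i, hi⟩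
    · intro x y hxy hx d' hd'
      obtain ⟨s, hs, hsd⟩ := hx ⟨(x, y), hxy⟩ rfl
      have h1 : (s * b) • d = ⟨(y, x), hxy.symm⟩ := by
        rw [mul_smul, hb, ← smul_dart_symm, hsd]
        rfl
      obtain ⟨i, hi⟩ := M.rot_sameCycle ((s * b) • d) d' (by rw [h1, hd'])
      refine ⟨s * b * a ^ (-i), S.mul_mem (S.mul_mem hs hbS) (S.zpow_mem haS _), ?_⟩
      rw [mul_smul, zpow_smul_eq ha, neg_neg, smul_rot_zpow, hi]
  rw [Subgroup.eq_top_iff']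
  intro g
  obtain ⟨s, hs, hsd⟩ := key _ (g • d) rfl
  rwa [← smul_dart_injective d hsd]

variable {p e : ℕ} [hp : Fact p.Prime]

theorem exists_mulEquiv_and_isomorphic (h5 : 5 ≤ p) {r : (ZMod (p ^ (e + 1)))ˣ}
    (hr : ∀ u, u ∈ Subgroup.zpowers r) (hM : M.IsOrientablyRegular)
    (ψ : Γ ≃g SimpleGraph.completeEquipartiteGraph p (p ^ e)) (P : Sylow p M.autPlus)
    (hP : Monoid.exponent P = p ^ (e + 1)) :
    Nonempty (M.autPlus ≃* G1 p e r) ∧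
      ∃ j : (ZMod (p ^ e * (p - 1)))ˣ, M.Isomorphic (M1 p e h5 r hr j) := by
  have hpos : 0 < p ^ e := pow_pos hp.out.pos e
  have hadj : ∀ x y, Γ.Adj x y ↔ (ψ x).1 ≠ (ψ y).1 := fun x y => ψ.map_adj_iff.symm
  have hnbr : ∀ v, ∃ d : Γ.Dart, d.fst = v := by
    intro v
    have : Nontrivial (Fin p) := Fin.nontrivial_iff_two_le.2 (by omega)
    obtain ⟨i, hi⟩ := exists_ne (ψ v).1
    exact ⟨⟨(v, ψ.symm (i, ⟨0, hpos⟩)), by rw [hadj]; simpa using hi.symm⟩, rfl⟩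
  obtain ⟨d, -⟩ := hnbr (ψ.symm (⟨0, hp.out.pos⟩, ⟨0, hpos⟩))
  have hfin : Finite V := M.finite
  have hfinD : Finite Γ.Dart := Finite.of_injective _ SimpleGraph.Dart.toProd_injective
  have hfinA : Finite M.autPlus := Finite.of_injective _ (smul_dart_injective (M := M) d)
  have hcard : Nat.card M.autPlus = p ^ (2 * e + 1) * (p - 1) := by
    rw [Nat.card_eq_of_bijective _ ⟨smul_dart_injective (M := M) d, hM.exists_smul_eq d⟩,
      natCard_dart_of_iso ψ]
    ring
  obtain ⟨a, ha⟩ := hM.exists_smul_eq d (M.rot⁻¹ d)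
  obtain ⟨b, hb⟩ := hM.exists_smul_eq d d.symm
  have hao : orderOf a = p ^ e * (p - 1) := by
    rw [orderOf_eq_natCard ha, natCard_dart_fst_of_iso ψ, mul_comm]
  have hafix : ∀ i : ℤ, a ^ i • d.fst = d.fst := by
    intro i
    rw [← smul_dart_fst, zpow_smul_eq ha, rot_zpow_fst]
  have hpart : ∀ (g : M.autPlus) x y, (ψ (g • x)).1 = (ψ (g • y)).1 ↔ (ψ x).1 = (ψ y).1 := by
    intro g x y
    have := smul_adj_iff g x y
    rw [hadj, hadj] at this
    exact not_iff_not.1 this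
  -- the stabilizer of the part that contains the initial vertex of `d`
  let H : Subgroup M.autPlus :=
    { carrier := {g | (ψ (g • d.fst)).1 = (ψ d.fst).1}
      one_mem' := by simp
      mul_mem' := by
        intro g h hg hh
        simp only [Set.mem_ofPred_eq] at hg hh ⊢
        rw [mul_smul, ← hg, hpart, hh]
      inv_mem' := by
        intro g hg
        simp only [Set.mem_ofPred_eq] at hg ⊢
        rw [← hpart g, smul_inv_smul, hg] }
  have hH : ∀ g, g ∈ H ↔ (ψ (g • d.fst)).1 = (ψ d.fst).1 := fun g => Iff.rfl
  -- Cosets of `H` correspond to parts, by transitivity on darts.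
  have hHi : H.index = p := by
    have hrel : ∀ g h : M.autPlus, (QuotientGroup.leftRel H) g h ↔
        (ψ (g • d.fst)).1 = (ψ (h • d.fst)).1 := by
      intro g h
      rw [QuotientGroup.leftRel_apply, hH, ← hpart g, mul_smul, smul_inv_smul, eq_comm]
    have hbij : Function.Bijective (Quotient.lift (fun g : M.autPlus => (ψ (g • d.fst)).1)
        (fun g h hgh => (hrel g h).1 hgh) : M.autPlus ⧸ H → Fin p) := by
      constructor
      · intro x y
        obtain ⟨g, rfl⟩ := QuotientGroup.mk_surjective x
        obtain ⟨h, rfl⟩ := QuotientGroup.mk_surjective y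
        intro hgh
        exact Quotient.sound ((hrel g h).2 hgh)
      · intro i
        obtain ⟨d', hd'⟩ := hnbr (ψ.symm (i, ⟨0, hpos⟩))
        obtain ⟨g, hg⟩ := hM.exists_smul_eq d d'
        refine ⟨QuotientGroup.mk g, ?_⟩
        change (ψ (g • d.fst)).1 = i
        rw [← smul_dart_fst, hg, hd']
        simp
    exact (Nat.card_eq_of_bijective _ hbij).trans (Nat.card_fin p)
  have haH : a ∈ H := by
    rw [hH]
    have := hafix 1
    rw [zpow_one] at this
    rw [this]
  have hmal : ∀ g ∉ H, ∀ i j : ℤ, a ^ i = g * a ^ j * g⁻¹ → a ^ i = 1 := by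
    intro g hg i j hij
    -- For `g ∉ H` the two vertices lie in different parts. An element of both stabilizers fixes the
    -- dart joining them, hence is trivial.
    have h1 : Γ.Adj d.fst (g • d.fst) := by
      rw [hadj]
      exact fun h => hg h.symm
    apply eq_one_of_smul_dart (d := (⟨(d.fst, g • d.fst), h1⟩ : Γ.Dart))
    ext
    · exact hafix i
    · change a ^ i • g • d.fst = g • d.fst
      rw [hij, ← mul_smul, inv_mul_cancel_right, mul_smul, hafix]
  have hbb : b * b = 1 := by
    apply eq_one_of_smul_dart (d := d)
    rw [mul_smul, hb, ← smul_dart_symm, hb, SimpleGraph.Dart.symm_symm]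
  have hbH : b ∉ H := by
    rw [hH, ← smul_dart_fst, hb]
    have := (hadj _ _).1 d.adj
    exact this.symm
  obtain ⟨φ, j, hφa, hφb⟩ := exists_mulEquiv_G1 h5 hr hao hcard haH hHi hmal hbb hbH
    (closure_eq_top_of_smul ha hb) P hP
  refine ⟨⟨φ.symm⟩, j, ?_⟩
  apply (G1.triple h5 hr j).isomorphic_toMap hM φ d
  · exact (congrArg (· • d) hφa).trans ha
  · exact (congrArg (· • d) hφb).trans hb

end OrientedMap

/-! ### The affine model and the graph underlying `𝓜₁(p, e, j)` -/

namespace G1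

variable {p e : ℕ} [hp : Fact p.Prime] {r : (ZMod (p ^ (e + 1)))ˣ}

lemma exists_affine_sub (g : G1 p e r) : ∃ u : (ZMod (p ^ (e + 1)))ˣ, ∀ x y,
    affine g x - affine g y = u * (x - y) := by
  have hg : g ∈ Subgroup.closure {a p e r, c p e r} := by rw [closure_eq_top]; trivial
  induction hg using Subgroup.closure_induction with
  | mem y hy =>
    rcases hy with rfl | rfl
    · refine ⟨r⁻¹, fun x y => ?_⟩
      have := affine_a_pow (p := p) (e := e) (r := r) 1
      simp only [pow_one] at this
      rw [this, this, mul_sub]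
    · exact ⟨1, fun x y => by simp [affine_c]⟩
  | one => exact ⟨1, fun x y => by simp⟩
  | mul g h _ _ hg hh =>
    obtain ⟨u, hu⟩ := hg
    obtain ⟨v, hv⟩ := hh
    exact ⟨u * v, fun x y => by simp [hu, hv, mul_assoc]⟩
  | inv g _ hg =>
    obtain ⟨u, hu⟩ := hg
    refine ⟨u⁻¹, fun x y => ?_⟩
    have h := hu (affine g⁻¹ x) (affine g⁻¹ y)
    have h1 : ∀ x, affine g (affine g⁻¹ x) = x := by
      intro x
      rw [← Equiv.Perm.mul_apply, ← map_mul, mul_inv_cancel, map_one, Equiv.Perm.one_apply]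
    rw [h1, h1] at h
    rw [h, Units.inv_mul_cancel_left]

lemma affine_c_pow (n : ℕ) (x : ZMod (p ^ (e + 1))) : affine (c p e r ^ n) x = n + x := by
  induction n generalizing x with
  | zero => simp
  | succ n ih =>
    rw [pow_succ (c p e r), map_mul, Equiv.Perm.mul_apply, affine_c, ih]
    push_cast
    ring

lemma affine_b (h5 : 5 ≤ p) (hr : ∀ u, u ∈ Subgroup.zpowers r) : affine (b p e r) 0 = -1 := by
  rw [b, map_mul, Equiv.Perm.mul_apply, affine_c, affine_a_pow, inv_pow, pow_half h5 hr]
  simp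

/-- The stabilizer of `0` is exactly `⟨a⟩`, since `c ^ n` moves `0` to `n`. So right cosets of `⟨a⟩`
are points, through `g ↦ g⁻¹ · 0`. -/
lemma affine_zero_eq_iff {g h : G1 p e r} :
    affine g⁻¹ 0 = affine h⁻¹ 0 ↔ h * g⁻¹ ∈ Subgroup.zpowers (a p e r) := by
  have h1 : affine g⁻¹ 0 = affine h⁻¹ 0 ↔ affine (h * g⁻¹) 0 = 0 := by
    rw [map_mul, Equiv.Perm.mul_apply, map_inv _ h]
    refine ⟨fun h0 => by rw [h0, perm_apply_inv_self], fun h0 => (affine h).injective ?_⟩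
    rw [h0, perm_apply_inv_self]
  rw [h1]
  constructor
  · intro h0
    obtain ⟨x, hx, y, hy, hxy⟩ := exists_eq_mul (h * g⁻¹)
    obtain ⟨k, rfl⟩ := exists_pow_of_mem hx
    have hfin : IsOfFinOrder (c p e r) := isOfFinOrder_of_finite _
    obtain ⟨n, rfl⟩ := hfin.mem_powers_iff_mem_zpowers.2 hy
    simp only at hxy
    rw [hxy, map_mul, Equiv.Perm.mul_apply, affine_a_pow, affine_c_pow, add_zero,
      Units.mul_right_eq_zero] at h0
    have hn : c p e r ^ n = 1 := by
      rw [← pow_zero (c p e r)]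
      exact c_pow_congr (by rw [h0, Nat.cast_zero])
    rw [hxy, hn, mul_one]
    exact hx
  · intro h0
    obtain ⟨k, hk⟩ := exists_pow_of_mem h0
    rw [← hk, affine_a_pow, mul_zero]

lemma isUnit_iff_cast_ne_zero (x : ZMod (p ^ (e + 1))) : IsUnit x ↔ (x.val : ZMod p) ≠ 0 := by
  conv_lhs => rw [← ZMod.natCast_zmod_val x]
  rw [ZMod.isUnit_iff_coprime, Nat.coprime_pow_right_iff (Nat.succ_pos e), Nat.coprime_comm,
    hp.out.coprime_iff_not_dvd, Ne, ZMod.natCast_eq_zero_iff]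

lemma isUnit_sub_iff (x y : ZMod (p ^ (e + 1))) :
    IsUnit (x - y) ↔ x.val % p ≠ y.val % p := by
  have hdvd : p ∣ p ^ (e + 1) := dvd_pow_self p (Nat.succ_ne_zero e)
  have h1 : ∀ z : ZMod (p ^ (e + 1)), (z.val : ZMod p) = ZMod.castHom hdvd (ZMod p) z := by
    intro z
    rw [ZMod.castHom_apply, ZMod.natCast_val]
  rw [isUnit_iff_cast_ne_zero, h1, map_sub, sub_ne_zero, ← h1, ← h1, Ne, Ne,
    ZMod.natCast_eq_natCast_iff']

/-- The graph on `ℤ/p^{e+1}` in which two elements are adjacent if they differ modulo `p` is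
complete multipartite. -/
noncomputable def residueEquiv (p e : ℕ) [hp : Fact p.Prime] :
    ZMod (p ^ (e + 1)) ≃ Fin p × Fin (p ^ e) where
  toFun x := (⟨x.val % p, Nat.mod_lt _ hp.out.pos⟩, ⟨x.val / p, by
    rw [Nat.div_lt_iff_lt_mul hp.out.pos, ← pow_succ]
    exact ZMod.val_lt x⟩)
  invFun q := ((q.1 + p * q.2 : ℕ) : ZMod (p ^ (e + 1)))
  left_inv x := by
    simp only
    rw [Nat.mod_add_div, ZMod.natCast_zmod_val]
  right_inv q := by
    obtain ⟨⟨i, hi⟩, ⟨j, hj⟩⟩ := q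
    have h1 : i + p * j < p ^ (e + 1) := by
      calc i + p * j < p + p * j := by omega
        _ = p * (j + 1) := by ring
        _ ≤ p * p ^ e := Nat.mul_le_mul_left _ hj
        _ = _ := by ring
    simp only [ZMod.val_natCast, Nat.mod_eq_of_lt h1]
    ext
    · simp [Nat.mod_eq_of_lt hi]
    · simp [Nat.add_mul_div_left _ _ hp.out.pos, Nat.div_eq_of_lt hi]

/-- The underlying graph of `𝓜₁(p, e, j)` is `K_{p[p^e]}`. -/
lemma nonempty_iso (h5 : 5 ≤ p) (hr : ∀ u, u ∈ Subgroup.zpowers r)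
    (j : (ZMod (p ^ e * (p - 1)))ˣ) : Nonempty ((G1.triple h5 hr j).cosetGraph ≃g
      SimpleGraph.completeEquipartiteGraph p (p ^ e)) := by
  set T := G1.triple h5 hr j with hT
  have hTa : Subgroup.zpowers T.a = Subgroup.zpowers (a p e r) := zpowers_a_pow j
  have hTb : T.b = b p e r := rfl
  have hcoset : ∀ g h, affine g⁻¹ 0 = affine h⁻¹ 0 ↔ T.coset g = T.coset h := by
    intro g h
    rw [affine_zero_eq_iff, T.coset_eq, hTa]
  let f : T.Vertex → ZMod (p ^ (e + 1)) := Quotient.lift (fun g => affine g⁻¹ 0)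
    (fun g h hgh => (hcoset g h).2 (Quotient.sound hgh))
  have hf : ∀ g, f (T.coset g) = affine g⁻¹ 0 := fun g => rfl
  have hfb : ∀ g, f (T.coset (T.b * g)) = affine g⁻¹ (-1) := by
    intro g
    have h1 : (b p e r)⁻¹ = b p e r := inv_eq_of_mul_eq_one_left (b_mul_self h5 hr)
    rw [hf, mul_inv_rev, hTb, h1, map_mul, Equiv.Perm.mul_apply, affine_b h5 hr]
  -- The witness has `g⁻¹ = c ^ x * a ^ k`, acting as `y ↦ x + u y` when `r ^ k = u⁻¹`. As `b · 0 =
  -- -1`, the arc of `g` joins `x` to `x - u`, so every pair differing by a unit is an edge.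
  have hex : ∀ (x : ZMod (p ^ (e + 1))) (u : (ZMod (p ^ (e + 1)))ˣ),
      ∃ g : G1 p e r, affine g⁻¹ 0 = x ∧ affine g⁻¹ (-1) = x - u := by
    intro x u
    obtain ⟨k, hk⟩ := mem_powers_iff_mem_zpowers.2 (hr u⁻¹)
    simp only at hk
    refine ⟨(c p e r ^ x.val * a p e r ^ k)⁻¹, ?_, ?_⟩
    · rw [inv_inv, map_mul, Equiv.Perm.mul_apply, affine_a_pow, affine_c_pow]
      simp
    · rw [inv_inv, map_mul, Equiv.Perm.mul_apply, affine_a_pow, affine_c_pow, inv_pow, hk, inv_inv,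
        ZMod.natCast_zmod_val]
      ring
  have hbij : Function.Bijective f := by
    constructor
    · intro u v huv
      obtain ⟨g, rfl⟩ := T.coset_surjective u
      obtain ⟨h, rfl⟩ := T.coset_surjective v
      exact (hcoset g h).1 huv
    · intro x
      obtain ⟨g, hg, -⟩ := hex x 1
      exact ⟨T.coset g, hg⟩
  refine ⟨{ (Equiv.ofBijective f hbij).trans (residueEquiv p e) with map_rel_iff' := ?_ }⟩
  intro v w
  change (residueEquiv p e (f v)).1 ≠ (residueEquiv p e (f w)).1 ↔ _
  have h1 : (residueEquiv p e (f v)).1 ≠ (residueEquiv p e (f w)).1 ↔ IsUnit (f v - f w) := by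
    rw [isUnit_sub_iff, Ne, Fin.ext_iff]
    rfl
  rw [h1]
  constructor
  · rintro ⟨u, hu⟩
    obtain ⟨g, hg1, hg2⟩ := hex (f v) u
    refine ⟨g, hbij.1 ?_, hbij.1 ?_⟩
    · rw [hf, hg1]
    · rw [hfb, hg2, hu, sub_sub_cancel]
  · rintro ⟨g, rfl, rfl⟩
    obtain ⟨u, hu⟩ := exists_affine_sub g⁻¹
    rw [hf, hfb, hu]
    simp

/-- An element fixing the base arc is a power of `a` that also fixes `b · 0 = -1`. Multiplication by
`r ^ (-k)` fixes `-1` only if `r ^ k = 1`, and then `a ^ k = 1`. -/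
lemma arc_injective (h5 : 5 ≤ p) (hr : ∀ u, u ∈ Subgroup.zpowers r)
    (j : (ZMod (p ^ e * (p - 1)))ˣ) : Function.Injective (G1.triple h5 hr j).arc := by
  intro g h hgh
  rw [AlgebraicTriple.arc_eq, AlgebraicTriple.coset_eq, AlgebraicTriple.coset_eq] at hgh
  change h * g⁻¹ ∈ Subgroup.zpowers (a p e r ^ (j : ZMod (p ^ e * (p - 1))).val) ∧
    b p e r * h * (b p e r * g)⁻¹ ∈
      Subgroup.zpowers (a p e r ^ (j : ZMod (p ^ e * (p - 1))).val) at hgh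
  rw [zpowers_a_pow] at hgh
  obtain ⟨h1, h2⟩ := hgh
  obtain ⟨k, hk⟩ := exists_pow_of_mem h1
  have hbinv : (b p e r)⁻¹ = b p e r := inv_eq_of_mul_eq_one_left (b_mul_self h5 hr)
  have h3 : affine (b p e r * h * (b p e r * g)⁻¹) 0 = 0 := by
    obtain ⟨l, hl⟩ := exists_pow_of_mem h2
    rw [← hl, affine_a_pow, mul_zero]
  have h4 : b p e r * h * (b p e r * g)⁻¹ = b p e r * (a p e r ^ k * b p e r) := by
    rw [mul_inv_rev, hbinv, hk]
    group
  have h5' : affine (b p e r) (-1) = 0 := by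
    have := congrArg (fun g => affine g 0) (b_mul_self (p := p) (e := e) h5 hr)
    simpa [affine_b h5 hr] using this
  rw [h4, map_mul, map_mul, Equiv.Perm.mul_apply, Equiv.Perm.mul_apply, affine_b h5 hr, ← h5',
    (affine (b p e r)).injective.eq_iff, affine_a_pow, mul_neg, neg_inj, mul_one, Units.val_eq_one,
    inv_pow, inv_eq_one] at h3
  have h6 := orderOf_dvd_of_pow_eq_one h3
  rw [orderOf_eq_card_of_forall_mem_zpowers hr, Nat.card_eq_fintype_card, card_units] at h6
  obtain ⟨m, rfl⟩ := h6
  rw [pow_mul, a_pow, one_pow] at hk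
  exact (mul_inv_eq_one.1 hk.symm).symm

end G1

/-! ### Monodromy and the invariance of `j` -/

namespace AlgebraicTriple

open OrientedMap

variable {H : Type*} [Group H] (T : AlgebraicTriple H)

/-- The action of words in the rotation and the dart reversal on the darts. -/
noncomputable def monodromy : FreeGroup (Fin 2) →* Equiv.Perm T.cosetGraph.Dart :=
  FreeGroup.lift ![T.rotation, SimpleGraph.Dart.symm_involutive.toPerm]

lemma monodromy_arc (w : FreeGroup (Fin 2)) (g : H) :
    T.monodromy w (T.arc g) = T.arc (FreeGroup.lift ![T.a, T.b] w * g) := by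
  induction w using FreeGroup.induction_on generalizing g with
  | C1 => simp
  | of i =>
    rw [monodromy, FreeGroup.lift_apply_of, FreeGroup.lift_apply_of]
    fin_cases i
    · exact T.rotation_arc g
    · ext
      · rfl
      · change T.coset g = T.coset (T.b * (T.b * g))
        rw [← mul_assoc, T.b_mul_self, one_mul]
  | inv_of i ih =>
    rw [map_inv, map_inv, Equiv.Perm.inv_eq_iff_eq, ih, mul_inv_cancel_left]
  | mul x y hx hy =>
    rw [map_mul, map_mul, Equiv.Perm.mul_apply, hy, hx, mul_assoc]

variable {T} {H' : Type*} [Group H'] {T' : AlgebraicTriple H'}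

lemma mapDart_monodromy {φ : T.cosetGraph ≃g T'.cosetGraph} (h : T.toMap.Preserves T'.toMap φ)
    (w : FreeGroup (Fin 2)) (d : T.cosetGraph.Dart) :
    φ.toHom.mapDart (T.monodromy w d) = T'.monodromy w (φ.toHom.mapDart d) := by
  induction w using FreeGroup.induction_on generalizing d with
  | C1 => simp
  | of i =>
    rw [monodromy, monodromy, FreeGroup.lift_apply_of, FreeGroup.lift_apply_of]
    fin_cases i
    · exact h d
    · rfl
  | inv_of i ih =>
    rw [map_inv, map_inv, Equiv.Perm.eq_inv_iff_eq, ← ih, perm_apply_inv_self]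
  | mul x y hx hy =>
    rw [map_mul, map_mul, Equiv.Perm.mul_apply, hx, hy, Equiv.Perm.mul_apply]

/-- The relations between the generators `a` and `b` depend only on the isomorphism type of the
map. -/
lemma lift_eq_one_of_isomorphic (h : T.toMap.Isomorphic T'.toMap)
    (hinj : Function.Injective T'.arc) {w : FreeGroup (Fin 2)}
    (hw : FreeGroup.lift ![T.a, T.b] w = 1) : FreeGroup.lift ![T'.a, T'.b] w = 1 := by
  obtain ⟨φ, hφ⟩ := h
  -- A word that is a relation in the first group fixes every arc of its map, in particular the one
  -- matched with `T'.arc 1`.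
  obtain ⟨g, hg⟩ := T.arc_surjective (φ.symm.toHom.mapDart (T'.arc 1))
  have h1 : φ.toHom.mapDart (T.arc g) = T'.arc 1 := by rw [hg, φ.mapDart_symm_mapDart]
  have h2 := mapDart_monodromy hφ w (T.arc g)
  rw [monodromy_arc, hw, one_mul, h1, monodromy_arc, mul_one] at h2
  exact (hinj h2).symm

end AlgebraicTriple

/-- With `n = p ^ e * (p - 1) / 2`, the element `c` is `A ^ (-n) * b` in the generators `A = a ^ j`
and `b`, whatever `j` is. The word below says `A⁻¹ * c * A = c ^ m`, which holds exactly when `c ^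
m` is the power of `c` with exponent `r ^ j`. An isomorphism preserves this relation, so `r ^ j₁ = r
^ j₂`, and the order of `r` is the modulus of the `jᵢ`. -/
theorem G1.eq_of_isomorphic {p e : ℕ} [hp : Fact p.Prime] (h5 : 5 ≤ p)
    {r : (ZMod (p ^ (e + 1)))ˣ} (hr : ∀ u, u ∈ Subgroup.zpowers r)
    {j₁ j₂ : (ZMod (p ^ e * (p - 1)))ˣ}
    (h : (M1 p e h5 r hr j₁).Isomorphic (M1 p e h5 r hr j₂)) : j₁ = j₂ := by
  have hN : NeZero (p ^ e * (p - 1)) := ⟨(card_pos p e).ne'⟩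
  set n := p ^ e * (p - 1) / 2 with hn
  have hlift : ∀ (j : (ZMod (p ^ e * (p - 1)))ˣ) (m : ℕ),
      FreeGroup.lift ![(G1.triple h5 hr j).a, (G1.triple h5 hr j).b]
        ((FreeGroup.of 0)⁻¹ * ((FreeGroup.of 0 ^ n)⁻¹ * FreeGroup.of 1) * FreeGroup.of 0 *
          (((FreeGroup.of 0 ^ n)⁻¹ * FreeGroup.of 1) ^ m)⁻¹) = 1 ↔
      c p e r ^ ((r ^ (j : ZMod (p ^ e * (p - 1))).val : (ZMod (p ^ (e + 1)))ˣ) :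
        ZMod (p ^ (e + 1))).val = c p e r ^ m := by
    intro j m
    have e1 : ((G1.triple h5 hr j).a ^ n)⁻¹ * (G1.triple h5 hr j).b = c p e r := by
      change ((a p e r ^ (j : ZMod (p ^ e * (p - 1))).val) ^ n)⁻¹ * (a p e r ^ n * c p e r) = _
      rw [hn, pow_half_of_coprime (a_pow p e r) (two_dvd h5) (ZMod.val_coe_unit_coprime j),
        inv_mul_cancel_left]
    simp only [map_mul, map_inv, map_pow, FreeGroup.lift_apply_of, Matrix.cons_val_zero,
      Matrix.cons_val_one, Matrix.cons_val_fin_one]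
    rw [e1, mul_inv_eq_one, ← conj_c_pow]
    rfl
  have h1 := AlgebraicTriple.lift_eq_one_of_isomorphic h (arc_injective h5 hr j₂)
    ((hlift j₁ _).2 rfl)
  rw [hlift] at h1
  have h2 := congrArg (fun g => affine g 0) h1
  simp only [affine_c_pow, add_zero, ZMod.natCast_zmod_val] at h2
  have h3 := Units.ext h2
  rw [pow_eq_pow_iff_modEq, orderOf_eq_card_of_forall_mem_zpowers hr, Nat.card_eq_fintype_card,
    card_units, ← ZMod.natCast_eq_natCast_iff, ZMod.natCast_zmod_val, ZMod.natCast_zmod_val] at h3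
  exact (Units.ext h3).symm

theorem theorem3p1 (p e : ℕ) [Fact p.Prime] (h5 : 5 ≤ p) (he : 1 ≤ e)
    (r : (ZMod (p ^ (e + 1)))ˣ) (hr : ∀ u, u ∈ Subgroup.zpowers r) :
    (∀ {V : Type*} (Γ : SimpleGraph V) (M : OrientedMap Γ),
      M.IsOrientablyRegularEmbeddingOf (SimpleGraph.completeEquipartiteGraph p (p ^ e)) →
      ∀ P : Sylow p M.autPlus, Monoid.exponent P = p ^ (e + 1) →
        Nonempty (M.autPlus ≃* G1 p e r) ∧
        ∃ j : (ZMod (p ^ e * (p - 1)))ˣ, M.Isomorphic (M1 p e h5 r hr j)) ∧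
    (∀ j : (ZMod (p ^ e * (p - 1)))ˣ,
      (M1 p e h5 r hr j).IsOrientablyRegularEmbeddingOf
        (SimpleGraph.completeEquipartiteGraph p (p ^ e))) ∧
    (∀ j₁ j₂ : (ZMod (p ^ e * (p - 1)))ˣ,
      (M1 p e h5 r hr j₁).Isomorphic (M1 p e h5 r hr j₂) → j₁ = j₂) := by
  refine ⟨?_, fun j => ⟨AlgebraicTriple.toMap_isOrientablyRegular _, G1.nonempty_iso h5 hr j⟩,
    fun j₁ j₂ h => G1.eq_of_isomorphic h5 hr h⟩
  rintro V Γ M ⟨hM, ⟨ψ⟩⟩ P hP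
  exact OrientedMap.exists_mulEquiv_and_isomorphic h5 hr hM ψ P hP
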